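/- Let $E_0\in\mathbb R$ and let $\phi:\mathbb R\to[0,\infty)$ satisfy $\phi\in C^1((-\infty,E_0))$, $\phi'(e)<0$ for $e<E_0$, and $\phi(e)=0$ for $e\ge E_0$. Let $E:\mathbb R^3\times\mathbb R^3\to\mathbb R$ be the particle energy of an isotropic steady state $f_0=\phi\circ E$ in one of the following two cases. Functions of $r=|x|$ are identified with spherically symmetric functions of $x$, and "$u$ is $C^2$" means that $u\in C^2([0,\infty))$ and that $x\mapsto u(|x|)$ is $C^2$ on $\mathbb R^3$. (Newtonian case, Vlasov–Poisson.) $E_0<0$, $E(x,v)=\frac12|v|^2+U_0(|x|)$, where $U_0$ is $C^2$, $\Delta U_0(x)=4\pi\int_{\mathbb R^3}\phi(E(x,v))\,dv$ on $\mathbb R^3$, and $\lim_{r\to\infty}U_0(r)=0$. (Relativistic case, spherically symmetric Einstein–Vlasov.) $0<E_0<1$, $E(x,v)=e^{\mu_0(|x|)}\sqrt{1+|v|^2}$, where $\lambda_0,\mu_0$ are $C^2$, $\lim_{r\to\infty}\lambda_0(r)=\lim_{r\to\infty}\mu_0(r)=0=\lambda_0(0)$, and for all $x\ne0$, with $r=|x|$,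 $$e^{-2\lambda_0}(2r\lambda_0'-1)+1=8\pi r^2\int_{\mathbb R^3}\sqrt{1+|v|^2}\,\phi(E(x,v))\,dv,$$ $$e^{-2\lambda_0}(2r\mu_0'+1)-1=8\pi r^2\int_{\mathbb R^3}\Big(\frac{x\cdot v}{r}\Big)^2\phi(E(x,v))\,\frac{dv}{\sqrt{1+|v|^2}}.$$ Let $S_0=\{(x,v): E(x,v)<E_0\}$. All functions are real-valued, and functions on $S_0$ are extended by $0$. A measurable $f:\mathbb R^3\times\mathbb R^3\to\mathbb R$ is spherically symmetric if for every $A\in SO(3)$, $f(Ax,Av)=f(x,v)$ for almost every $(x,v)$; a subscript $r$ denotes spherically symmetric functions. For $\xi\in C^1(S_0)$ put $$\mathcal T\xi=\{\xi,E\}=\partial_vE\cdot\partial_x\xi-\partial_xE\cdot\partial_v\xi .$$ For $f\in L^1_{\mathrm{loc},r}(S_0)$ say that $\mathcal Tf=g$ weakly if $g\in L^1_{\mathrm{loc},r}(S_0)$ and $$\int_{S_0}\frac{1}{|\phi'\circ E|}\,f\,\mathcal T\xi=-\int_{S_0}\frac1{|\phi'\circ E|}\,g\,\xi\qquad\text{for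 all }\xi\in C^\infty_{c,r}(S_0).$$ Let $H$ be the real Hilbert space of all $f\in L^1_{\mathrm{loc},r}(S_0)$ (modulo equality a.e.) with $\int_{S_0}\frac{1}{|\phi'\circ E|}f^2<\infty$, with scalar product $\langle f,g\rangle_H=\int_{S_0}\frac1{|\phi'\circ E|}fg$, and let $$D(\mathcal T)=\{f\in H:\ \mathcal Tf\text{ exists weakly and }\mathcal Tf\in H\}.$$ Theorem. In both cases, $\mathcal T: H\supset D(\mathcal T)\to H$ is a well-defined (that is, single-valued), densely defined linear operator, and it is skew-adjoint: $\mathcal T^*=-\mathcal T$ (including equality of domains). -/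

import Mathlib

open MeasureTheory Filter Topology
open scoped ContDiff

noncomputable section

/-- Three-dimensional Euclidean space. -/
abbrev E3 : Type := EuclideanSpace ℝ (Fin 3)

/-- Phase space: pairs `z = (x, v)` of position and velocity (momentum), with Lebesgue measure. -/
abbrev Phase : Type := E3 × E3

/-! ### Isotropic steady states -/

/-- Ansatz functions `φ : ℝ → [0, ∞)` with cut-off energy `E₀`. -/
structure IsAnsatz (φ : ℝ → ℝ) (E₀ : ℝ) : Prop where
  nonneg : ∀ e, 0 ≤ φ e
  contDiffOn : ContDiffOn ℝ 1 φ (Set.Iio E₀)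
  deriv_neg : ∀ e < E₀, deriv φ e < 0
  eq_zero : ∀ e, E₀ ≤ e → φ e = 0

/-- `u : [0, ∞) → ℝ` (extended arbitrarily to negative arguments) is `C²` as a function of the
radius, and `x ↦ u |x|` is `C²` on `ℝ³`. -/
def IsRadialC2 (u : ℝ → ℝ) : Prop :=
  ContDiffOn ℝ 2 u (Set.Ici 0) ∧ ContDiff ℝ 2 (fun x : E3 => u ‖x‖)

/-- The Newtonian particle energy `|v|² / 2 + U₀(|x|)`. -/
def newtonianEnergy (U₀ : ℝ → ℝ) (z : Phase) : ℝ :=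
  ‖z.2‖ ^ 2 / 2 + U₀ ‖z.1‖

/-- The relativistic particle energy `exp(μ₀(|x|)) √(1 + |v|²)`. -/
def relativisticEnergy (μ₀ : ℝ → ℝ) (z : Phase) : ℝ :=
  Real.exp (μ₀ ‖z.1‖) * √(1 + ‖z.2‖ ^ 2)

/-- `f₀ = φ ∘ E` is a steady state of the Vlasov-Poisson system, with spherically symmetric
potential `U₀`.  The Vlasov equation itself holds since `f₀` is a function of the energy `E`; what
remains is the Poisson equation and the boundary condition at infinity.  (The integrand defining
the spatial density is bounded, measurable and of compact support in `v`.) -/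
structure IsNewtonianSteadyState (φ : ℝ → ℝ) (E₀ : ℝ) (U₀ : ℝ → ℝ) : Prop where
  ansatz : IsAnsatz φ E₀
  cutoff_neg : E₀ < 0
  regular : IsRadialC2 U₀
  poisson : ∀ x : E3, Laplacian.laplacian (fun y : E3 => U₀ ‖y‖) x =
    4 * Real.pi * ∫ v : E3, φ (newtonianEnergy U₀ (x, v))
  tendsto_zero : Tendsto U₀ atTop (𝓝 0)

/-- `f₀ = φ ∘ E` is a steady state of the spherically symmetric Einstein-Vlasov system, with metric
components `λ₀`, `μ₀`; again the Vlasov equation holds since `f₀` is a function of `E`, and what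
remains are the two field equations and the boundary conditions. -/
structure IsRelativisticSteadyState (φ : ℝ → ℝ) (E₀ : ℝ) (lam₀ μ₀ : ℝ → ℝ) : Prop where
  ansatz : IsAnsatz φ E₀
  cutoff_pos : 0 < E₀
  cutoff_lt_one : E₀ < 1
  regular_lam : IsRadialC2 lam₀
  regular_mu : IsRadialC2 μ₀
  field_rho : ∀ x : E3, x ≠ 0 →
    Real.exp (-2 * lam₀ ‖x‖) * (2 * ‖x‖ * deriv lam₀ ‖x‖ - 1) + 1 =
      8 * Real.pi * ‖x‖ ^ 2 *
        ∫ v : E3, √(1 + ‖v‖ ^ 2) * φ (relativisticEnergy μ₀ (x, v))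
  field_p : ∀ x : E3, x ≠ 0 →
    Real.exp (-2 * lam₀ ‖x‖) * (2 * ‖x‖ * deriv μ₀ ‖x‖ + 1) - 1 =
      8 * Real.pi * ‖x‖ ^ 2 *
        ∫ v : E3, (inner ℝ x v / ‖x‖) ^ 2 * φ (relativisticEnergy μ₀ (x, v)) / √(1 + ‖v‖ ^ 2)
  lam_tendsto_zero : Tendsto lam₀ atTop (𝓝 0)
  mu_tendsto_zero : Tendsto μ₀ atTop (𝓝 0)
  lam_zero : lam₀ 0 = 0

/-- An isotropic steady state: an ansatz function `φ`, a cut-off energy `E₀` and a particle energy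
`E`, belonging to a steady state of the Vlasov-Poisson (Newtonian case) or of the spherically
symmetric Einstein-Vlasov system (relativistic case). -/
structure IsotropicSteadyState where
  φ : ℝ → ℝ
  E₀ : ℝ
  E : Phase → ℝ
  isSteadyState :
    (∃ U₀ : ℝ → ℝ, IsNewtonianSteadyState φ E₀ U₀ ∧ E = newtonianEnergy U₀) ∨
    (∃ lam₀ μ₀ : ℝ → ℝ, IsRelativisticSteadyState φ E₀ lam₀ μ₀ ∧ E = relativisticEnergy μ₀)

/-! ### Poisson bracket and spherical symmetry -/

/-- The gradient with respect to position. -/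
def gradX (f : Phase → ℝ) (z : Phase) : E3 := gradient (fun x : E3 => f (x, z.2)) z.1

/-- The gradient with respect to velocity. -/
def gradV (f : Phase → ℝ) (z : Phase) : E3 := gradient (fun v : E3 => f (z.1, v)) z.2

/-- `{f, g} = ∂ᵥ g ⬝ ∂ₓ f - ∂ₓ g ⬝ ∂ᵥ f`. -/
def poissonBracket (f g : Phase → ℝ) (z : Phase) : ℝ :=
  inner ℝ (gradV g z) (gradX f z) - inner ℝ (gradX g z) (gradV f z)

/-- Elements of `SO(3)`. -/
def IsRotation (A : E3 ≃ₗᵢ[ℝ] E3) : Prop :=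
  LinearMap.det (A.toLinearEquiv : E3 →ₗ[ℝ] E3) = 1

/-- The diagonal action `(x, v) ↦ (A x, A v)` on phase space. -/
def rotate (A : E3 ≃ₗᵢ[ℝ] E3) (z : Phase) : Phase := (A z.1, A z.2)

/-- Spherical symmetry; the exceptional null set may depend on the rotation. -/
def IsSphericallySymmetric (f : Phase → ℝ) : Prop :=
  ∀ A : E3 ≃ₗᵢ[ℝ] E3, IsRotation A → ∀ᵐ z : Phase, f (rotate A z) = f z

namespace IsotropicSteadyState

variable (s : IsotropicSteadyState)

/-- The set `S₀ = {E < E₀}` on which `f₀` is positive. -/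
def S₀ : Set Phase := {z | s.E z < s.E₀}

/-- The weight `1 / |φ' ∘ E|`. -/
def weight (z : Phase) : ℝ := 1 / |deriv s.φ (s.E z)|

/-- The classical transport operator `𝒯 f = {f, E}`. -/
def classicalT (f : Phase → ℝ) : Phase → ℝ := poissonBracket f s.E

/-- Membership in `L¹_{loc,r}(S₀)`: locally integrable on `S₀` and, after extension by zero,
spherically symmetric. -/
def IsL1LocR (f : Phase → ℝ) : Prop :=
  LocallyIntegrableOn f s.S₀ volume ∧ IsSphericallySymmetric (s.S₀.indicator f)

/-- Test functions: the space `C^∞_{c,r}(S₀)` (functions extended by zero). -/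
structure IsTestFunction (ξ : Phase → ℝ) : Prop where
  smooth : ContDiff ℝ ∞ ξ
  hasCompactSupport : HasCompactSupport ξ
  tsupport_subset : tsupport ξ ⊆ s.S₀
  symm : IsSphericallySymmetric ξ

/-- `𝒯 f = g` weakly, for `f, g ∈ L¹_{loc,r}(S₀)`. -/
def IsWeakT (f g : Phase → ℝ) : Prop :=
  s.IsL1LocR f ∧ s.IsL1LocR g ∧ ∀ ξ : Phase → ℝ, s.IsTestFunction ξ →
    ∫ z in s.S₀, s.weight z * (f z * s.classicalT ξ z) =
      -∫ z in s.S₀, s.weight z * (g z * ξ z)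

/-- The measure `1 / |φ' ∘ E| dz` on `S₀`. -/
def weightedMeasure : Measure Phase :=
  (volume.restrict s.S₀).withDensity fun z => ENNReal.ofReal (s.weight z)

/-! ### Elementary facts that the definitions need -/

lemma ansatz : IsAnsatz s.φ s.E₀ := by
  rcases s.isSteadyState with ⟨U, h, -⟩ | ⟨l, m, h, -⟩
  · exact h.ansatz
  · exact h.ansatz

lemma contDiff_E : ContDiff ℝ 2 s.E := by
  rcases s.isSteadyState with ⟨U, h, hE⟩ | ⟨l, m, h, hE⟩
  · rw [hE]
    have h1 : ContDiff ℝ 2 (fun z : Phase => U ‖z.1‖) := h.regular.2.comp contDiff_fst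
    have h2 : ContDiff ℝ 2 (fun z : Phase => ‖z.2‖ ^ 2 / 2) :=
      ((contDiff_norm_sq ℝ).comp contDiff_snd).div_const 2
    exact h2.add h1
  · rw [hE]
    have h1 : ContDiff ℝ 2 (fun z : Phase => Real.exp (m ‖z.1‖)) :=
      Real.contDiff_exp.comp (h.regular_mu.2.comp contDiff_fst)
    have h2 : ContDiff ℝ 2 (fun z : Phase => √(1 + ‖z.2‖ ^ 2)) := by
      refine ContDiff.sqrt (contDiff_const.add ((contDiff_norm_sq ℝ).comp contDiff_snd)) ?_
      intro z
      positivity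
    exact h1.mul h2

lemma E_rotate (A : E3 ≃ₗᵢ[ℝ] E3) (z : Phase) : s.E (rotate A z) = s.E z := by
  rcases s.isSteadyState with ⟨U, h, hE⟩ | ⟨l, m, h, hE⟩ <;> rw [hE] <;>
    simp [newtonianEnergy, relativisticEnergy, rotate]

lemma isOpen_S₀ : IsOpen s.S₀ := isOpen_lt s.contDiff_E.continuous continuous_const

lemma measurableSet_S₀ : MeasurableSet s.S₀ := s.isOpen_S₀.measurableSet

lemma rotate_mem_S₀ (A : E3 ≃ₗᵢ[ℝ] E3) (z : Phase) : rotate A z ∈ s.S₀ ↔ z ∈ s.S₀ := by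
  simp [S₀, s.E_rotate]

lemma weight_rotate (A : E3 ≃ₗᵢ[ℝ] E3) (z : Phase) : s.weight (rotate A z) = s.weight z := by
  simp [weight, s.E_rotate]

lemma weight_pos {z : Phase} (hz : z ∈ s.S₀) : 0 < s.weight z :=
  one_div_pos.2 (abs_pos.2 (s.ansatz.deriv_neg _ hz).ne)

lemma continuousOn_weight : ContinuousOn s.weight s.S₀ := by
  have h1 : ContinuousOn (deriv s.φ) (Set.Iio s.E₀) :=
    s.ansatz.contDiffOn.continuousOn_deriv_of_isOpen isOpen_Iio le_rfl
  have h2 : ContinuousOn (fun z => |deriv s.φ (s.E z)|) s.S₀ :=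
    (h1.comp s.contDiff_E.continuous.continuousOn fun z hz => hz).abs
  exact continuousOn_const.div h2 fun z hz => (abs_pos.2 (s.ansatz.deriv_neg _ hz).ne).ne'

lemma measurable_weight : Measurable s.weight :=
  measurable_const.div
    (((measurable_deriv s.φ).comp s.contDiff_E.continuous.measurable).abs)

lemma ae_weightedMeasure_iff {p : Phase → Prop} :
    (∀ᵐ z ∂s.weightedMeasure, p z) ↔ ∀ᵐ z ∂(volume.restrict s.S₀), p z := by
  rw [weightedMeasure, ae_withDensity_iff s.measurable_weight.ennreal_ofReal]
  constructor
  · intro h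
    filter_upwards [h, ae_restrict_mem s.measurableSet_S₀] with z hz hS
    exact hz (by simpa using s.weight_pos hS)
  · intro h
    filter_upwards [h] with z hz _ using hz

lemma measurePreserving_rotate (A : E3 ≃ₗᵢ[ℝ] E3) :
    MeasurePreserving (rotate A) (volume : Measure Phase) volume :=
  A.measurePreserving.prod A.measurePreserving

lemma measurePreserving_rotate_weightedMeasure (A : E3 ≃ₗᵢ[ℝ] E3) :
    MeasurePreserving (rotate A) s.weightedMeasure s.weightedMeasure := by
  have hA := measurePreserving_rotate A
  refine ⟨hA.measurable, ?_⟩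
  ext t ht
  have hpre : rotate A ⁻¹' t ∩ s.S₀ = rotate A ⁻¹' (t ∩ s.S₀) := by
    ext z
    simp [s.rotate_mem_S₀]
  rw [Measure.map_apply hA.measurable ht, weightedMeasure, withDensity_apply _ ht,
    withDensity_apply _ (hA.measurable ht), Measure.restrict_restrict ht,
    Measure.restrict_restrict (hA.measurable ht), hpre,
    ← hA.setLIntegral_comp_preimage (ht.inter s.measurableSet_S₀)
      s.measurable_weight.ennreal_ofReal]
  simp [s.weight_rotate]

variable {s}

lemma indicator_congr {f g : Phase → ℝ} (h : f =ᵐ[volume.restrict s.S₀] g) :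
    s.S₀.indicator f =ᵐ[volume] s.S₀.indicator g :=
  (ae_eq_restrict_iff_indicator_ae_eq s.measurableSet_S₀).1 h

lemma _root_.IsSphericallySymmetric.congr {f g : Phase → ℝ} (hf : IsSphericallySymmetric f)
    (h : f =ᵐ[volume] g) : IsSphericallySymmetric g := by
  intro A hA
  filter_upwards [hf A hA, h, (measurePreserving_rotate A).quasiMeasurePreserving.ae h]
    with z h1 h2 h3
  rw [← h2, ← h3, h1]

lemma IsL1LocR.congr {f g : Phase → ℝ} (hf : s.IsL1LocR f)
    (h : f =ᵐ[volume.restrict s.S₀] g) : s.IsL1LocR g :=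
  ⟨hf.1.congr h, hf.2.congr (indicator_congr h)⟩

lemma IsL1LocR.zero : s.IsL1LocR (fun _ => 0) :=
  ⟨locallyIntegrableOn_zero, fun A _ => by simp⟩

lemma IsL1LocR.add {f g : Phase → ℝ} (hf : s.IsL1LocR f) (hg : s.IsL1LocR g) :
    s.IsL1LocR (f + g) := by
  refine ⟨hf.1.add hg.1, fun A hA => ?_⟩
  filter_upwards [hf.2 A hA, hg.2 A hA] with z h1 h2
  rw [Set.indicator_add', Pi.add_apply, Pi.add_apply, h1, h2]

lemma IsL1LocR.smul {f : Phase → ℝ} (c : ℝ) (hf : s.IsL1LocR f) : s.IsL1LocR (c • f) := by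
  refine ⟨hf.1.smul c, fun A hA => ?_⟩
  filter_upwards [hf.2 A hA] with z h1
  have h2 : s.S₀.indicator (c • f) = c • s.S₀.indicator f := by
    ext y
    by_cases hy : y ∈ s.S₀ <;> simp [hy]
  rw [h2, Pi.smul_apply, Pi.smul_apply, h1]

variable (s)

lemma ae_eq_restrict {f g : Phase → ℝ} (h : f =ᵐ[s.weightedMeasure] g) :
    f =ᵐ[volume.restrict s.S₀] g :=
  s.ae_weightedMeasure_iff.1 h

lemma isSphericallySymmetric_indicator_iff (f : Phase → ℝ) :
    IsSphericallySymmetric (s.S₀.indicator f) ↔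
      ∀ A : E3 ≃ₗᵢ[ℝ] E3, IsRotation A → ∀ᵐ z ∂s.weightedMeasure, f (rotate A z) = f z := by
  refine forall_congr' fun A => imp_congr_right fun _ => ?_
  rw [s.ae_weightedMeasure_iff, ae_restrict_iff' s.measurableSet_S₀]
  refine eventually_congr (Eventually.of_forall fun z => ?_)
  by_cases hz : z ∈ s.S₀
  · rw [Set.indicator_of_mem hz, Set.indicator_of_mem ((s.rotate_mem_S₀ A z).2 hz)]
    exact ⟨fun h _ => h, fun h => h hz⟩
  · rw [Set.indicator_of_notMem hz, Set.indicator_of_notMem (mt (s.rotate_mem_S₀ A z).1 hz)]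
    exact ⟨fun _ h => absurd h hz, fun _ => rfl⟩

lemma integral_weightedMeasure (f : Phase → ℝ) :
    ∫ z, f z ∂s.weightedMeasure = ∫ z in s.S₀, s.weight z * f z := by
  rw [weightedMeasure, integral_withDensity_eq_integral_toReal_smul
    s.measurable_weight.ennreal_ofReal (by simp)]
  refine setIntegral_congr_fun s.measurableSet_S₀ fun z hz => ?_
  simp [(s.weight_pos hz).le]

/-- Functions with finite weighted `L²` norm are locally integrable on `S₀`. -/
lemma locallyIntegrableOn_of_memLp {f : Phase → ℝ} (hf : MemLp f 2 s.weightedMeasure) :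
    LocallyIntegrableOn f s.S₀ volume := by
  rw [locallyIntegrableOn_iff s.isOpen_S₀.isLocallyClosed]
  intro K hKS hK
  have hac : volume.restrict s.S₀ ≪ s.weightedMeasure :=
    Measure.AbsolutelyContinuous.mk fun t _ ht => by
      have h1 : ∀ᵐ z ∂s.weightedMeasure, z ∉ t := by simpa [ae_iff] using ht
      simpa [ae_iff] using s.ae_weightedMeasure_iff.1 h1
  have hm : AEStronglyMeasurable f (volume.restrict K) :=
    (hf.1.mono_ac hac).mono_measure (Measure.restrict_mono hKS le_rfl)
  have h2 : Integrable (fun z => f z ^ 2) s.weightedMeasure := hf.integrable_sq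
  rw [weightedMeasure, integrable_withDensity_iff_integrable_smul'
    s.measurable_weight.ennreal_ofReal (by simp)] at h2
  have h3 : IntegrableOn (fun z => s.weight z * f z ^ 2) K volume := by
    refine IntegrableOn.congr_fun (IntegrableOn.mono_set h2 hKS) (fun z hz => ?_)
      hK.measurableSet
    simp [(s.weight_pos (hKS hz)).le]
  have h4 : IntegrableOn (fun z => s.weight z * f z ^ 2 * (s.weight z)⁻¹) K volume :=
    h3.mul_continuousOn ((s.continuousOn_weight.mono hKS).inv₀
      fun z hz => (s.weight_pos (hKS hz)).ne') hK
  have h5 : IntegrableOn (fun _ : Phase => (1 : ℝ)) K volume :=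
    integrableOn_const hK.measure_lt_top.ne
  refine (h5.add h4).mono' hm ?_
  filter_upwards [ae_restrict_mem hK.measurableSet] with z hz
  have hw := s.weight_pos (hKS hz)
  have h6 : s.weight z * f z ^ 2 * (s.weight z)⁻¹ = f z ^ 2 := by field_simp
  simp only [Pi.add_apply, h6, Real.norm_eq_abs]
  nlinarith [sq_nonneg (|f z| - 1), sq_abs (f z), abs_nonneg (f z)]

/-! ### The Hilbert space `H` -/

/-- The Hilbert space `H` of all `f ∈ L¹_{loc,r}(S₀)` (modulo equality almost everywhere) with
`∫_{S₀} f² / |φ' ∘ E| < ∞`.  Its scalar product is `∫_{S₀} f g / |φ' ∘ E|`, see `inner_eq`. -/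
def H : Submodule ℝ (Lp ℝ 2 s.weightedMeasure) where
  carrier := {f | s.IsL1LocR f}
  zero_mem' := IsL1LocR.zero.congr
    (s.ae_eq_restrict (Lp.coeFn_zero ℝ 2 s.weightedMeasure)).symm
  add_mem' {f g} hf hg := (IsL1LocR.add hf hg).congr
    (s.ae_eq_restrict (Lp.coeFn_add f g)).symm
  smul_mem' c f hf := (IsL1LocR.smul c hf).congr
    (s.ae_eq_restrict (Lp.coeFn_smul c f)).symm

lemma mem_H {f : Lp ℝ 2 s.weightedMeasure} : f ∈ s.H ↔ s.IsL1LocR f := Iff.rfl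

lemma isClosed_H : IsClosed (s.H : Set (Lp ℝ 2 s.weightedMeasure)) := by
  have key : (s.H : Set (Lp ℝ 2 s.weightedMeasure)) =
      ⋂ (A : E3 ≃ₗᵢ[ℝ] E3) (_ : IsRotation A), {f | Lp.compMeasurePreserving (rotate A)
        (s.measurePreserving_rotate_weightedMeasure A) f = f} := by
    ext f
    simp only [SetLike.mem_coe, mem_H, IsL1LocR, Set.mem_iInter, Set.mem_ofPred_eq,
      s.locallyIntegrableOn_of_memLp (Lp.memLp f), true_and,
      isSphericallySymmetric_indicator_iff]
    refine forall_congr' fun A => imp_congr_right fun _ => ?_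
    have h := Lp.coeFn_compMeasurePreserving f (s.measurePreserving_rotate_weightedMeasure A)
    rw [Lp.ext_iff]
    constructor
    · intro h1
      exact h.trans h1
    · intro h1
      exact h.symm.trans h1
  rw [key]
  refine isClosed_iInter fun A => isClosed_iInter fun _ => isClosed_eq ?_ continuous_id
  exact (Lp.isometry_compMeasurePreserving _).continuous

instance : CompleteSpace s.H := s.isClosed_H.completeSpace_coe

/-- The scalar product of `H` is the weighted one. -/
lemma inner_eq (f g : s.H) :
    inner ℝ f g = ∫ z in s.S₀, s.weight z * ((f : Lp ℝ 2 s.weightedMeasure) z *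
      (g : Lp ℝ 2 s.weightedMeasure) z) := by
  rw [← s.integral_weightedMeasure
    fun z => (f : Lp ℝ 2 s.weightedMeasure) z * (g : Lp ℝ 2 s.weightedMeasure) z,
    Submodule.coe_inner, L2.inner_def]
  refine integral_congr_ae (Eventually.of_forall fun z => ?_)
  simp [mul_comm]

/-! ### The transport operator on `H` -/

lemma gradX_eq {f : Phase → ℝ} (hf : ContDiff ℝ 1 f) (z : Phase) :
    gradX f z = (InnerProductSpace.toDual ℝ E3).symm
      ((fderiv ℝ f z).comp (ContinuousLinearMap.inl ℝ E3 E3)) := by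
  have h1 : HasFDerivAt f (fderiv ℝ f z) (z.1, z.2) :=
    (hf.differentiable one_ne_zero z).hasFDerivAt
  have h2 := h1.comp (f := fun x : E3 => (x, z.2)) z.1 (hasFDerivAt_prodMk_left z.1 z.2)
  rw [gradX, gradient]
  exact congrArg _ h2.fderiv

lemma gradV_eq {f : Phase → ℝ} (hf : ContDiff ℝ 1 f) (z : Phase) :
    gradV f z = (InnerProductSpace.toDual ℝ E3).symm
      ((fderiv ℝ f z).comp (ContinuousLinearMap.inr ℝ E3 E3)) := by
  have h1 : HasFDerivAt f (fderiv ℝ f z) (z.1, z.2) :=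
    (hf.differentiable one_ne_zero z).hasFDerivAt
  have h2 := h1.comp (f := fun v : E3 => (z.1, v)) z.2 (hasFDerivAt_prodMk_right z.1 z.2)
  rw [gradV, gradient]
  exact congrArg _ h2.fderiv

lemma continuous_gradX {f : Phase → ℝ} (hf : ContDiff ℝ 1 f) : Continuous (gradX f) := by
  rw [show gradX f = _ from funext (gradX_eq hf)]
  exact (LinearIsometryEquiv.continuous _).comp
    ((hf.continuous_fderiv one_ne_zero).clm_comp continuous_const)

lemma continuous_gradV {f : Phase → ℝ} (hf : ContDiff ℝ 1 f) : Continuous (gradV f) := by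
  rw [show gradV f = _ from funext (gradV_eq hf)]
  exact (LinearIsometryEquiv.continuous _).comp
    ((hf.continuous_fderiv one_ne_zero).clm_comp continuous_const)

lemma continuous_classicalT {f : Phase → ℝ} (hf : ContDiff ℝ 1 f) :
    Continuous (s.classicalT f) := by
  have hE : ContDiff ℝ 1 s.E := s.contDiff_E.of_le one_le_two
  exact ((continuous_gradV hE).inner (continuous_gradX hf)).sub
    ((continuous_gradX hE).inner (continuous_gradV hf))

lemma classicalT_eq_zero {f : Phase → ℝ} (hf : ContDiff ℝ 1 f) {z : Phase}
    (hz : z ∉ tsupport f) : s.classicalT f z = 0 := by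
  have h : fderiv ℝ f z = 0 := by
    by_contra h
    exact hz (support_fderiv_subset ℝ h)
  simp [classicalT, poissonBracket, gradX_eq hf, gradV_eq hf, h]

/-- The integrals in the weak formulation exist. -/
lemma integrableOn_pairing {f g : Phase → ℝ} {K : Set Phase}
    (hf : LocallyIntegrableOn f s.S₀ volume) (hg : Continuous g) (hK : IsCompact K)
    (hKS : K ⊆ s.S₀) (hgK : ∀ z ∉ K, g z = 0) :
    IntegrableOn (fun z => s.weight z * (f z * g z)) s.S₀ volume := by
  have h1 : IntegrableOn f K volume := hf.integrableOn_compact_subset hKS hK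
  have h2 := h1.mul_continuousOn
    ((s.continuousOn_weight.mono hKS).mul hg.continuousOn) hK
  have h3 : IntegrableOn (fun z => s.weight z * (f z * g z)) K volume :=
    h2.congr_fun (fun z _ => by simp only [Pi.mul_apply]; ring) hK.measurableSet
  exact h3.of_forall_sdiff_eq_zero s.measurableSet_S₀ fun z hz => by simp [hgK z hz.2]

variable {s}

lemma IsTestFunction.integrableOn_mul {ξ : Phase → ℝ} (hξ : s.IsTestFunction ξ)
    {f : Phase → ℝ} (hf : s.IsL1LocR f) :
    IntegrableOn (fun z => s.weight z * (f z * ξ z)) s.S₀ volume :=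
  s.integrableOn_pairing hf.1 hξ.smooth.continuous hξ.hasCompactSupport hξ.tsupport_subset
    fun _ hz => image_eq_zero_of_notMem_tsupport hz

lemma IsTestFunction.integrableOn_classicalT {ξ : Phase → ℝ} (hξ : s.IsTestFunction ξ)
    {f : Phase → ℝ} (hf : s.IsL1LocR f) :
    IntegrableOn (fun z => s.weight z * (f z * s.classicalT ξ z)) s.S₀ volume :=
  have h1 : ContDiff ℝ 1 ξ := hξ.smooth.of_le (by norm_cast)
  s.integrableOn_pairing hf.1 (s.continuous_classicalT h1) hξ.hasCompactSupport
    hξ.tsupport_subset fun _ hz => s.classicalT_eq_zero h1 hz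

lemma IsWeakT.congr {f g f' g' : Phase → ℝ} (h : s.IsWeakT f g)
    (hf : f =ᵐ[volume.restrict s.S₀] f') (hg : g =ᵐ[volume.restrict s.S₀] g') :
    s.IsWeakT f' g' := by
  refine ⟨h.1.congr hf, h.2.1.congr hg, fun ξ hξ => ?_⟩
  have h1 : ∫ z in s.S₀, s.weight z * (f z * s.classicalT ξ z) =
      ∫ z in s.S₀, s.weight z * (f' z * s.classicalT ξ z) :=
    integral_congr_ae (hf.mono fun z hz => by simp only [hz])
  have h2 : ∫ z in s.S₀, s.weight z * (g z * ξ z) =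
      ∫ z in s.S₀, s.weight z * (g' z * ξ z) :=
    integral_congr_ae (hg.mono fun z hz => by simp only [hz])
  rw [← h1, ← h2, h.2.2 ξ hξ]

lemma IsWeakT.zero : s.IsWeakT (fun _ => 0) (fun _ => 0) :=
  ⟨IsL1LocR.zero, IsL1LocR.zero, fun ξ _ => by simp⟩

lemma IsWeakT.add {f g f' g' : Phase → ℝ} (h : s.IsWeakT f g) (h' : s.IsWeakT f' g') :
    s.IsWeakT (f + f') (g + g') := by
  refine ⟨h.1.add h'.1, h.2.1.add h'.2.1, fun ξ hξ => ?_⟩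
  simp only [Pi.add_apply, add_mul, mul_add]
  rw [integral_add (hξ.integrableOn_classicalT h.1) (hξ.integrableOn_classicalT h'.1),
    integral_add (hξ.integrableOn_mul h.2.1) (hξ.integrableOn_mul h'.2.1),
    h.2.2 ξ hξ, h'.2.2 ξ hξ]
  ring

lemma IsWeakT.smul {f g : Phase → ℝ} (c : ℝ) (h : s.IsWeakT f g) :
    s.IsWeakT (c • f) (c • g) := by
  refine ⟨h.1.smul c, h.2.1.smul c, fun ξ hξ => ?_⟩
  simp only [Pi.smul_apply, smul_eq_mul, mul_assoc, mul_left_comm _ c, integral_const_mul]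
  rw [h.2.2 ξ hξ]
  ring

variable (s)

/-- The relation `𝒯 f = g` weakly, for `f, g ∈ H`, as a subspace of `H × H`. -/
def weakGraph : Submodule ℝ (s.H × s.H) where
  carrier := {p | s.IsWeakT (p.1 : Lp ℝ 2 s.weightedMeasure) (p.2 : Lp ℝ 2 s.weightedMeasure)}
  zero_mem' := IsWeakT.zero.congr
    (s.ae_eq_restrict (Lp.coeFn_zero ℝ 2 s.weightedMeasure)).symm
    (s.ae_eq_restrict (Lp.coeFn_zero ℝ 2 s.weightedMeasure)).symm
  add_mem' hp hq := (IsWeakT.add hp hq).congr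
    (s.ae_eq_restrict (Lp.coeFn_add _ _)).symm (s.ae_eq_restrict (Lp.coeFn_add _ _)).symm
  smul_mem' c _ hp := (IsWeakT.smul c hp).congr
    (s.ae_eq_restrict (Lp.coeFn_smul _ _)).symm (s.ae_eq_restrict (Lp.coeFn_smul _ _)).symm

/-- The transport operator `𝒯 : H ⊇ D(𝒯) → H`, with domain
`D(𝒯) = {f ∈ H | 𝒯 f exists weakly and lies in H}`: the operator with graph `weakGraph`. -/
def transport : s.H →ₗ.[ℝ] s.H := s.weakGraph.toLinearPMap

lemma mem_domain_transport {f : s.H} : f ∈ s.transport.domain ↔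
    ∃ g : s.H, s.IsWeakT (f : Lp ℝ 2 s.weightedMeasure) (g : Lp ℝ 2 s.weightedMeasure) := by
  simp [transport, Submodule.toLinearPMap_domain, weakGraph]

end IsotropicSteadyState

end

/-! The weak relation 𝒯 f = g says ⟨f, 𝒯 ξ⟩ = -⟨g, ξ⟩ for all test functions ξ. Weak 𝒯 is thus minus
the adjoint of 𝒯 on test functions. Once test functions are known to lie in the weak graph
(`IsTestFunction.isWeakT`), every pair in the graph of -𝒯* lies in the graph of 𝒯. The substance is
the reverse inclusion, skew symmetry ⟨f, 𝒯 q⟩ + ⟨𝒯 f, q⟩ = 0 on the whole maximal domain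
(`IsWeakT.skew`), where neither function is smooth.

Two devices give it. The first is that functions of the energy commute with 𝒯, because {θ ∘ E, E} =
0. Cutoffs θ(E) therefore localize the weak relation to sublevel sets {E ≤ e} with e < E₀, which are
compact. Since θ(E) ξ need not be smooth when E is merely C², the relation is first extended to C¹
test functions. Polynomials in E may then be inserted, and by Weierstrass approximation all
continuous functions of E; this removes the weight 1/|φ' ∘ E|, which is merely continuous on S₀
(`IsWeakT.integral_comp_E_mul_unweighted`).

The second is Friedrichs' commutator lemma. For the localized pairs, each relation is tested with
the mollification of the other function. The sum of the two transport terms is a commutator of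
mollification with the Hamiltonian vector field of E. It is bounded on L² uniformly in the
mollification parameter and tends to a multiple of the divergence of that field, which is zero
because second derivatives of E commute (`IsMollifier.tendsto_integral_hamiltonianDeriv`). The
mollifier is invariant under rotations, so that the approximations stay spherically symmetric and
are admissible. Exhausting S₀ by cutoffs finishes the proof of skew symmetry.

Single-valuedness follows by testing a relation 𝒯 0 = g with mollifications of localized g. Density
follows from it: if y is orthogonal to the domain, then (0, y) is in the weak graph, hence y = 0. -/

set_option linter.unusedSectionVars false

/-! ### Bilinear forms on L² dominated by convolution kernels -/

section Mollifier

open scoped Convolution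

variable {V : Type*} [NormedAddCommGroup V] [NormedSpace ℝ V] [FiniteDimensional ℝ V]
  [MeasurableSpace V] [BorelSpace V] {μ : Measure V} [μ.IsAddHaarMeasure]

/-- Integrability of the integrand of a bilinear form dominated by a convolution kernel. -/
lemma integrable_kernel {k : V × V → ℝ} {K f q : V → ℝ}
    (hk : AEStronglyMeasurable k (μ.prod μ)) (hK : Integrable K μ)
    (hkK : ∀ p : V × V, |k p| ≤ K (p.1 - p.2)) (hf : MemLp f 2 μ) (hq : MemLp q 2 μ) :
    Integrable (fun p : V × V => f p.1 * q p.2 * k p) (μ.prod μ) := by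
  have h1 : Integrable (fun p : V × V => q p.2 ^ 2 * K (p.1 - p.2)) (μ.prod μ) :=
    hq.integrable_sq.convolution_integrand (ContinuousLinearMap.mul ℝ ℝ) hK
  have h2 : Integrable (fun p : V × V => f p.1 ^ 2 * K (p.1 - p.2)) (μ.prod μ) := by
    have := (hf.integrable_sq.convolution_integrand (ContinuousLinearMap.mul ℝ ℝ)
      hK.comp_neg).swap
    simpa [Function.comp_def] using this
  refine (h1.add h2).mono' ((hf.1.comp_fst.mul hq.1.comp_snd).mul hk)
    (Eventually.of_forall fun p => ?_)
  have h3 := hkK p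
  have h4 := (abs_nonneg _).trans h3
  rw [Real.norm_eq_abs, abs_mul, abs_mul]
  calc |f p.1| * |q p.2| * |k p| ≤ |f p.1| * |q p.2| * K (p.1 - p.2) := by gcongr
    _ ≤ (q p.2 ^ 2 + f p.1 ^ 2) * K (p.1 - p.2) := by
        gcongr
        nlinarith [sq_nonneg (|f p.1| - |q p.2|), sq_abs (f p.1), sq_abs (q p.2),
          sq_nonneg (f p.1), sq_nonneg (q p.2)]
    _ = _ := by simp only [Pi.add_apply]; ring

/-- A weighted form of Young's inequality for bilinear forms. -/
lemma abs_integral_kernel_le {k : V × V → ℝ} {K f q : V → ℝ}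
    (hK : Integrable K μ)
    (hkK : ∀ p : V × V, |k p| ≤ K (p.1 - p.2)) (hf : MemLp f 2 μ) (hq : MemLp q 2 μ)
    {a : ℝ} (ha : 0 < a) :
    |∫ p, f p.1 * q p.2 * k p ∂(μ.prod μ)| ≤
      (∫ z, K z ∂μ) * (a * ∫ z, f z ^ 2 ∂μ + a⁻¹ * ∫ z, q z ^ 2 ∂μ) := by
  have h1 : Integrable (fun p : V × V => q p.2 ^ 2 * K (p.1 - p.2)) (μ.prod μ) :=
    hq.integrable_sq.convolution_integrand (ContinuousLinearMap.mul ℝ ℝ) hK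
  have h2' : Integrable (fun p : V × V => f p.2 ^ 2 * K (-(p.1 - p.2))) (μ.prod μ) :=
    hf.integrable_sq.convolution_integrand (ContinuousLinearMap.mul ℝ ℝ) hK.comp_neg
  have h2 : Integrable (fun p : V × V => f p.1 ^ 2 * K (p.1 - p.2)) (μ.prod μ) := by
    simpa [Function.comp_def] using h2'.swap
  have e1 : ∫ p : V × V, q p.2 ^ 2 * K (p.1 - p.2) ∂(μ.prod μ) =
      (∫ z, q z ^ 2 ∂μ) * ∫ z, K z ∂μ := by
    rw [integral_prod _ h1]
    exact integral_convolution (ContinuousLinearMap.mul ℝ ℝ) hq.integrable_sq hK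
  have e2 : ∫ p : V × V, f p.1 ^ 2 * K (p.1 - p.2) ∂(μ.prod μ) =
      (∫ z, f z ^ 2 ∂μ) * ∫ z, K z ∂μ := by
    have h3 : ∫ p : V × V, f p.2 ^ 2 * K (-(p.1 - p.2)) ∂(μ.prod μ) =
        (∫ z, f z ^ 2 ∂μ) * ∫ z, K (-z) ∂μ := by
      rw [integral_prod _ h2']
      exact integral_convolution (ContinuousLinearMap.mul ℝ ℝ) hf.integrable_sq hK.comp_neg
    rw [integral_neg_eq_self] at h3
    rw [← h3, ← integral_prod_swap]
    simp
  rw [← Real.norm_eq_abs]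
  refine (norm_integral_le_of_norm_le ((h2.const_mul a).add (h1.const_mul a⁻¹))
    (Eventually.of_forall fun p => ?_)).trans_eq ?_
  · have h3 := hkK p
    have h4 := (abs_nonneg _).trans h3
    rw [Real.norm_eq_abs, abs_mul, abs_mul]
    calc |f p.1| * |q p.2| * |k p| ≤ |f p.1| * |q p.2| * K (p.1 - p.2) := by gcongr
      _ ≤ (a * f p.1 ^ 2 + a⁻¹ * q p.2 ^ 2) * K (p.1 - p.2) := by
          gcongr
          have h5 : a⁻¹ * (a * |f p.1| - |q p.2|) ^ 2 =
            a * f p.1 ^ 2 + a⁻¹ * q p.2 ^ 2 - 2 * (|f p.1| * |q p.2|) := by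
            rw [← sq_abs (f p.1), ← sq_abs (q p.2)]; field_simp; ring
          have h6 : 0 ≤ a⁻¹ * (a * |f p.1| - |q p.2|) ^ 2 := by positivity
          have h7 : 0 ≤ |f p.1| * |q p.2| := by positivity
          linarith
      _ = _ := by simp only [Pi.add_apply]; ring
  · simp only [Pi.add_apply]
    rw [integral_add (h2.const_mul a) (h1.const_mul a⁻¹), integral_const_mul, integral_const_mul,
      e1, e2]
    ring

lemma exists_smooth_integral_sub_sq_le {q : V → ℝ} (hq : MemLp q 2 μ) {δ : ℝ} (hδ : 0 < δ) :
    ∃ u : V → ℝ, HasCompactSupport u ∧ ContDiff ℝ ∞ u ∧ MemLp u 2 μ ∧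
      ∫ z, (q z - u z) ^ 2 ∂μ ≤ δ := by
  obtain ⟨u, hu1, hu2, hu3⟩ := MeasureTheory.MemLp.exist_eLpNorm_sub_le (by simp)
    (by norm_num : (1 : ENNReal) ≤ 2) hq (Real.sqrt_pos.2 hδ)
  have hu4 : MemLp u 2 μ := hu2.continuous.memLp_of_hasCompactSupport hu1
  refine ⟨u, hu1, hu2, hu4, ?_⟩
  have h1 := (hq.sub hu4).eLpNorm_eq_integral_rpow_norm (by simp) (by simp)
  rw [h1] at hu3
  have h2 := (ENNReal.ofReal_le_ofReal_iff (Real.sqrt_nonneg _)).1 hu3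
  simp only [ENNReal.toReal_ofNat, Pi.sub_apply, Real.rpow_ofNat, Real.norm_eq_abs, sq_abs] at h2
  rw [← one_div, ← Real.sqrt_eq_rpow] at h2
  exact (Real.sqrt_le_sqrt_iff hδ.le).1 h2

/-- Counterpart of `abs_integral_kernel_le` for the limiting form, whose kernel is the multiplier
`d` on the diagonal. -/
lemma abs_integral_mul_le {f q d : V → ℝ} {D : ℝ} (hd : AEStronglyMeasurable d μ)
    (hdD : ∀ z, |d z| ≤ D) (hf : MemLp f 2 μ) (hq : MemLp q 2 μ) {a : ℝ} (ha : 0 < a) :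
    Integrable (fun z => f z * q z * d z) μ ∧
    |∫ z, f z * q z * d z ∂μ| ≤
      D * (a * ∫ z, f z ^ 2 ∂μ + a⁻¹ * ∫ z, q z ^ 2 ∂μ) := by
  have h1 := ((hf.integrable_sq.const_mul a).add (hq.integrable_sq.const_mul a⁻¹)).const_mul D
  have key : ∀ z, ‖f z * q z * d z‖ ≤ D * (a * f z ^ 2 + a⁻¹ * q z ^ 2) := by
    intro z
    have h3 := hdD z
    have h4 := (abs_nonneg _).trans h3
    rw [Real.norm_eq_abs, abs_mul, abs_mul]
    calc |f z| * |q z| * |d z| ≤ |f z| * |q z| * D := by gcongr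
      _ ≤ (a * f z ^ 2 + a⁻¹ * q z ^ 2) * D := by
          gcongr
          have h5 : a⁻¹ * (a * |f z| - |q z|) ^ 2 =
            a * f z ^ 2 + a⁻¹ * q z ^ 2 - 2 * (|f z| * |q z|) := by
            rw [← sq_abs (f z), ← sq_abs (q z)]; field_simp; ring
          have h6 : 0 ≤ a⁻¹ * (a * |f z| - |q z|) ^ 2 := by positivity
          have h7 : 0 ≤ |f z| * |q z| := by positivity
          linarith
      _ = _ := by ring
  refine ⟨h1.mono' ((hf.1.mul hq.1).mul hd) (Eventually.of_forall key), ?_⟩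
  rw [← Real.norm_eq_abs]
  refine (norm_integral_le_of_norm_le h1 (Eventually.of_forall key)).trans_eq ?_
  simp only [Pi.add_apply]
  rw [integral_const_mul, integral_add (hf.integrable_sq.const_mul a)
    (hq.integrable_sq.const_mul a⁻¹), integral_const_mul, integral_const_mul]

/-- Uniformly bounded bilinear forms on `L²` converge as soon as they do for smooth arguments. -/
lemma tendsto_integral_kernel_of_smooth {k : ℕ → V × V → ℝ} {K : ℕ → V → ℝ} {C D : ℝ}
    {f q d : V → ℝ}
    (hk : ∀ n, AEStronglyMeasurable (k n) (μ.prod μ)) (hK : ∀ n, Integrable (K n) μ)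
    (hkK : ∀ n, ∀ p : V × V, |k n p| ≤ K n (p.1 - p.2)) (hC : ∀ n, ∫ z, K n z ∂μ ≤ C)
    (hd : AEStronglyMeasurable d μ) (hdD : ∀ z, |d z| ≤ D)
    (hf : MemLp f 2 μ) (hq : MemLp q 2 μ)
    (h : ∀ u : V → ℝ, HasCompactSupport u → ContDiff ℝ ∞ u →
      Tendsto (fun n => ∫ p, f p.1 * u p.2 * k n p ∂(μ.prod μ)) atTop
        (𝓝 (∫ z, f z * u z * d z ∂μ))) :
    Tendsto (fun n => ∫ p, f p.1 * q p.2 * k n p ∂(μ.prod μ)) atTop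
      (𝓝 (∫ z, f z * q z * d z ∂μ)) := by
  rw [Metric.tendsto_atTop]
  intro ε hε
  have hC0 : 0 ≤ C := le_trans (integral_nonneg fun z => by
    simpa using (abs_nonneg _).trans (hkK 0 (z, 0))) (hC 0)
  have hD0 : 0 ≤ D := (abs_nonneg _).trans (hdD 0)
  set F := ∫ z, f z ^ 2 ∂μ
  have hF : 0 ≤ F := integral_nonneg fun z => sq_nonneg _
  -- `M` dominates both the kernel mass `C` and the multiplier bound `D`, and the summand 1 makes it
  -- positive. The parameters `a` and `δ` make each of the two terms in the weighted Young
  -- inequality at most ε/(6M), so that replacing `q` by a smooth `u` costs at most ε/3 in either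
  -- form.
  set M := C + D + 1
  have hM : 0 < M := by positivity
  set a := ε / (6 * M * (F + 1))
  have ha : 0 < a := by positivity
  set δ := a * ε / (6 * M)
  have hδ : 0 < δ := by positivity
  obtain ⟨u, hu1, hu2, hu3, hu4⟩ := exists_smooth_integral_sub_sq_le hq hδ
  have hqu := hq.sub hu3
  have small : ∀ N : ℝ, 0 ≤ N → N ≤ M →
      N * (a * F + a⁻¹ * ∫ z, (q - u) z ^ 2 ∂μ) ≤ ε / 3 := by
    intro N h0 hN
    have h1 : a * F ≤ ε / (6 * M) := by
      have : a * (F + 1) = ε / (6 * M) := by simp only [a]; field_simp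
      nlinarith
    have h2 : a⁻¹ * ∫ z, (q - u) z ^ 2 ∂μ ≤ ε / (6 * M) := by
      have : a⁻¹ * δ = ε / (6 * M) := by simp only [δ]; field_simp
      rw [← this]
      gcongr
      exact hu4
    calc N * (a * F + a⁻¹ * ∫ z, (q - u) z ^ 2 ∂μ) ≤ M * (ε / (6 * M) + ε / (6 * M)) := by
          have : 0 ≤ ∫ z, (q - u) z ^ 2 ∂μ := integral_nonneg fun z => sq_nonneg _
          gcongr
      _ = ε / 3 := by field_simp; ring
  obtain ⟨n₀, hn₀⟩ := Metric.tendsto_atTop.1 (h u hu1 hu2) (ε / 3) (by positivity)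
  refine ⟨n₀, fun n hn => ?_⟩
  have i1 := integrable_kernel (hk n) (hK n) (hkK n) hf hq
  have i2 := integrable_kernel (hk n) (hK n) (hkK n) hf hu3
  have j1 := (abs_integral_mul_le hd hdD hf hq one_pos).1
  have j2 := (abs_integral_mul_le hd hdD hf hu3 one_pos).1
  have b1 := abs_integral_kernel_le (hK n) (hkK n) hf hqu ha
  have b2 := (abs_integral_mul_le hd hdD hf hqu ha).2
  have s1 := b1.trans (small _ (integral_nonneg fun z => by
    simpa using (abs_nonneg _).trans (hkK n (z, 0))) ((hC n).trans (by simp only [M]; linarith)))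
  have s2 := b2.trans (small D hD0 (by simp only [M]; linarith))
  have e1 : ∫ p, f p.1 * (q - u) p.2 * k n p ∂(μ.prod μ) =
      ∫ p, f p.1 * q p.2 * k n p ∂(μ.prod μ) - ∫ p, f p.1 * u p.2 * k n p ∂(μ.prod μ) := by
    rw [← integral_sub i1 i2]
    refine integral_congr_ae (Eventually.of_forall fun p => ?_)
    simp only [Pi.sub_apply]; ring
  have e2 : ∫ z, f z * (q - u) z * d z ∂μ =
      ∫ z, f z * q z * d z ∂μ - ∫ z, f z * u z * d z ∂μ := by
    rw [← integral_sub j1 j2]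
    refine integral_congr_ae (Eventually.of_forall fun p => ?_)
    simp only [Pi.sub_apply]; ring
  have s3 := hn₀ n hn
  rw [e1] at s1
  rw [e2] at s2
  rw [Real.dist_eq] at s3 ⊢
  rw [abs_le] at s1 s2
  rw [abs_lt] at s3 ⊢
  constructor <;> linarith [s1.1, s1.2, s2.1, s2.2, s3.1, s3.2]

end Mollifier

/-! ### Approximate identities and Friedrichs' commutator lemma -/

section Mollifier

open scoped Convolution

variable {V : Type*} [NormedAddCommGroup V] [NormedSpace ℝ V] [FiniteDimensional ℝ V]
  [MeasurableSpace V] [BorelSpace V] {μ : Measure V} [μ.IsAddHaarMeasure]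

/-- The convolution of `u` with the kernel `k`. -/
noncomputable def mollify (μ : Measure V) (k u : V → ℝ) : V → ℝ :=
  u ⋆[ContinuousLinearMap.mul ℝ ℝ, μ] k

omit [NormedSpace ℝ V] [FiniteDimensional ℝ V] [BorelSpace V] [μ.IsAddHaarMeasure] in
lemma mollify_apply (k u : V → ℝ) (z : V) : mollify μ k u z = ∫ t, u t * k (z - t) ∂μ := rfl

lemma mollify_comm (k u : V → ℝ) : mollify μ k u = mollify μ u k := by
  ext z
  rw [mollify, convolution_mul_swap, mollify_apply]
  exact integral_congr_ae (Eventually.of_forall fun t => mul_comm _ _)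

lemma fderiv_mollify {k u : V → ℝ} (hk : ContDiff ℝ 1 k) (hkc : HasCompactSupport k)
    (hu : LocallyIntegrable u μ) (z a : V) :
    fderiv ℝ (mollify μ k u) z a = mollify μ (fun y => fderiv ℝ k y a) u z := by
  rw [mollify, (hkc.hasFDerivAt_convolution_right (ContinuousLinearMap.mul ℝ ℝ) hu hk z).fderiv,
    convolution_precompR_apply _ hu (hkc.fderiv ℝ) (hk.continuous_fderiv one_ne_zero)]
  rfl

lemma fderiv_mollify_right {k u : V → ℝ} (hk : LocallyIntegrable k μ)
    (hu : ContDiff ℝ 1 u) (huc : HasCompactSupport u) (z a : V) :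
    fderiv ℝ (mollify μ k u) z a = mollify μ k (fun y => fderiv ℝ u y a) z := by
  rw [mollify_comm, fderiv_mollify hu huc hk, mollify_comm]

lemma contDiff_mollify {k u : V → ℝ} (hk : ContDiff ℝ ∞ k) (hkc : HasCompactSupport k)
    (hu : LocallyIntegrable u μ) : ContDiff ℝ ∞ (mollify μ k u) :=
  hkc.contDiff_convolution_right _ hu hk

/-- Sequences of smooth even approximate identities with bounded first moments of the gradient. -/
structure IsMollifier (μ : Measure V) (ρ : ℕ → V → ℝ) : Prop where
  smooth : ∀ n, ContDiff ℝ ∞ (ρ n)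
  nonneg : ∀ (n : ℕ) z, 0 ≤ ρ n z
  even : ∀ (n : ℕ) z, ρ n (-z) = ρ n z
  integral_eq_one : ∀ n, ∫ z, ρ n z ∂μ = 1
  eq_zero : ∀ (n : ℕ) z, 1 / ((n : ℝ) + 1) < ‖z‖ → ρ n z = 0
  moment : ∃ C, ∀ n, ∫ z, ‖z‖ * ‖fderiv ℝ (ρ n) z‖ ∂μ ≤ C

namespace IsMollifier

variable {ρ : ℕ → V → ℝ} (hρ : IsMollifier μ ρ)

include hρ

lemma tsupport_subset (n : ℕ) : tsupport (ρ n) ⊆ Metric.closedBall 0 (1 / ((n : ℝ) + 1)) := by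
  refine closure_minimal (fun z hz => ?_) Metric.isClosed_closedBall
  by_contra h
  exact hz (hρ.eq_zero n z (by simpa using h))

lemma hasCompactSupport (n : ℕ) : HasCompactSupport (ρ n) :=
  (isCompact_closedBall 0 _).of_isClosed_subset (isClosed_tsupport _) (hρ.tsupport_subset n)

lemma contDiff_one (n : ℕ) : ContDiff ℝ 1 (ρ n) := (hρ.smooth n).of_le (by norm_cast)

lemma continuous_fderiv_apply (n : ℕ) (a : V) : Continuous fun y => fderiv ℝ (ρ n) y a :=
  ((hρ.contDiff_one n).continuous_fderiv one_ne_zero).clm_apply continuous_const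

lemma integrable (n : ℕ) : Integrable (ρ n) μ :=
  (hρ.smooth n).continuous.integrable_of_hasCompactSupport (hρ.hasCompactSupport n)

lemma fderiv_neg (n : ℕ) (z a : V) : fderiv ℝ (ρ n) (-z) a = -fderiv ℝ (ρ n) z a := by
  have h1 : HasFDerivAt (ρ n) (fderiv ℝ (ρ n) (-z)) (-z) :=
    ((hρ.contDiff_one n).differentiable one_ne_zero _).hasFDerivAt
  have h2 := h1.comp z (hasFDerivAt_id z).neg
  rw [show ρ n ∘ Neg.neg = ρ n from funext (hρ.even n)] at h2
  rw [h2.fderiv]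
  simp

lemma abs_mollify_le {u : V → ℝ} {M : ℝ} (hM : ∀ z, |u z| ≤ M) (n : ℕ) (z : V) :
    |mollify μ (ρ n) u z| ≤ M := by
  have h1 : Integrable (fun t => M * ρ n (z - t)) μ :=
    ((hρ.integrable n).comp_sub_left z).const_mul M
  have h2 := norm_integral_le_of_norm_le (f := fun t => u t * ρ n (z - t)) h1
    (Eventually.of_forall fun t => by
      rw [Real.norm_eq_abs, abs_mul, abs_of_nonneg (hρ.nonneg n _)]
      exact mul_le_mul_of_nonneg_right (hM t) (hρ.nonneg n _))
  rwa [integral_const_mul, integral_sub_left_eq_self (ρ n) μ z, hρ.integral_eq_one, mul_one,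
    Real.norm_eq_abs] at h2

lemma tendsto_mollify {u : V → ℝ} (hu : Continuous u) (z : V) :
    Tendsto (fun n => mollify μ (ρ n) u z) atTop (𝓝 (u z)) := by
  have h := convolution_tendsto_right (μ := μ) (φ := ρ) (g := fun _ => u) (x₀ := z)
    (z₀ := u z) (k := fun _ => z) (l := atTop)
    (Eventually.of_forall hρ.nonneg) (Eventually.of_forall hρ.integral_eq_one) ?_
    (Eventually.of_forall fun _ => hu.aestronglyMeasurable)
    ((hu.tendsto z).comp tendsto_snd) tendsto_const_nhds
  · refine h.congr fun n => ?_
    rw [mollify_comm]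
    rfl
  · rw [tendsto_smallSets_iff]
    intro t ht
    obtain ⟨ε, hε, hball⟩ := Metric.mem_nhds_iff.1 ht
    have h1 := (tendsto_one_div_add_atTop_nhds_zero_nat (𝕜 := ℝ)).eventually (gt_mem_nhds hε)
    filter_upwards [h1] with n hn z hz
    refine hball ?_
    have := hρ.tsupport_subset n (subset_tsupport _ hz)
    exact lt_of_le_of_lt this hn

lemma continuous_mollify {u : V → ℝ} (hu : LocallyIntegrable u μ) (n : ℕ) :
    Continuous (mollify μ (ρ n) u) :=
  (contDiff_mollify (hρ.smooth n) (hρ.hasCompactSupport n) hu).continuous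

lemma tendsto_integral_mul_mollify {F u : V → ℝ} (hF : Integrable F μ) (hu : Continuous u)
    (huc : HasCompactSupport u) :
    Tendsto (fun n => ∫ z, F z * mollify μ (ρ n) u z ∂μ) atTop (𝓝 (∫ z, F z * u z ∂μ)) := by
  obtain ⟨M, hM⟩ := hu.bounded_above_of_compact_support huc
  refine tendsto_integral_of_dominated_convergence (fun z => |F z| * M) (fun n => ?_)
    (hF.abs.mul_const M) (fun n => Eventually.of_forall fun z => ?_)
    (Eventually.of_forall fun z => (hρ.tendsto_mollify hu z).const_mul _)
  · exact hF.1.mul (hρ.continuous_mollify hu.locallyIntegrable n).aestronglyMeasurable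
  · rw [Real.norm_eq_abs, abs_mul]
    exact mul_le_mul_of_nonneg_left (hρ.abs_mollify_le hM n z) (abs_nonneg _)

omit hρ in
/-- Fubini for a kernel of convolution type. -/
lemma integral_mul_mollify {c k f q : V → ℝ} {M : ℝ} (hc : Continuous c) (hcM : ∀ z, |c z| ≤ M)
    (hk : Continuous k) (hki : Integrable k μ)
    (hf : MemLp f 2 μ) (hq : MemLp q 2 μ) :
    Integrable (fun p : V × V => f p.1 * q p.2 * (c p.1 * k (p.1 - p.2))) (μ.prod μ) ∧
    Integrable (fun z => f z * (c z * mollify μ k q z)) μ ∧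
    ∫ p : V × V, f p.1 * q p.2 * (c p.1 * k (p.1 - p.2)) ∂(μ.prod μ) =
      ∫ z, f z * (c z * mollify μ k q z) ∂μ := by
  have h1 : Integrable (fun p : V × V => f p.1 * q p.2 * (c p.1 * k (p.1 - p.2)))
      (μ.prod μ) := by
    refine integrable_kernel (K := fun y => M * |k y|) ?_ (hki.abs.const_mul M) (fun p => ?_) hf hq
    · exact (Continuous.mul (by fun_prop) (by fun_prop)).aestronglyMeasurable
    · rw [abs_mul]
      exact mul_le_mul_of_nonneg_right (hcM _) (abs_nonneg _)
  have h2 : (fun z => ∫ t, f z * q t * (c z * k (z - t)) ∂μ) =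
      fun z => f z * (c z * mollify μ k q z) := by
    ext z
    rw [mollify_apply, ← integral_const_mul, ← integral_const_mul]
    refine integral_congr_ae (Eventually.of_forall fun t => ?_)
    simp only
    ring
  refine ⟨h1, ?_, ?_⟩
  · rw [← h2]
    exact h1.integral_prod_left
  · rw [integral_prod _ h1, ← h2]

/-- Mollification is a symmetric operator. -/
lemma integral_mul_mollify_comm {f q : V → ℝ} (hf : MemLp f 2 μ) (hq : MemLp q 2 μ) (n : ℕ) :
    ∫ z, f z * mollify μ (ρ n) q z ∂μ = ∫ z, q z * mollify μ (ρ n) f z ∂μ := by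
  have h1 := (integral_mul_mollify (μ := μ) (c := fun _ => 1) (M := 1) continuous_const (by simp)
    (hρ.smooth n).continuous (hρ.integrable n) hf hq).2.2
  have h2 := (integral_mul_mollify (μ := μ) (c := fun _ => 1) (M := 1) continuous_const (by simp)
    (hρ.smooth n).continuous (hρ.integrable n) hq hf).2.2
  simp only [one_mul] at h1 h2
  rw [← h1, ← h2, ← integral_prod_swap]
  refine integral_congr_ae (Eventually.of_forall fun p => ?_)
  simp only [Prod.fst_swap, Prod.snd_swap]
  rw [← hρ.even n, neg_sub]
  ring

/-- Weak convergence of mollifications in L²: the kernels have mass 1, so the claim reduces to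
smooth `q`, where dominated convergence applies. -/
lemma tendsto_integral_mul_mollify_of_memLp {f q : V → ℝ} (hf : MemLp f 2 μ)
    (hfi : Integrable f μ) (hq : MemLp q 2 μ) :
    Tendsto (fun n => ∫ z, f z * mollify μ (ρ n) q z ∂μ) atTop (𝓝 (∫ z, f z * q z ∂μ)) := by
  have fub : ∀ n, ∀ u : V → ℝ, MemLp u 2 μ →
      ∫ p : V × V, f p.1 * u p.2 * ρ n (p.1 - p.2) ∂(μ.prod μ) =
        ∫ z, f z * mollify μ (ρ n) u z ∂μ := fun n u hu => by
    simpa only [one_mul] using (integral_mul_mollify (μ := μ) (c := fun _ => 1) (M := 1)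
      continuous_const (by simp) (hρ.smooth n).continuous (hρ.integrable n) hf hu).2.2
  have h := tendsto_integral_kernel_of_smooth (μ := μ) (f := f) (q := q) (d := fun _ => 1)
    (k := fun n p => ρ n (p.1 - p.2)) (K := ρ) (C := 1) (D := 1)
    (fun n => ((hρ.smooth n).continuous.comp
      (continuous_fst.sub continuous_snd)).aestronglyMeasurable)
    hρ.integrable (fun n p => (abs_of_nonneg (hρ.nonneg n _)).le)
    (fun n => (hρ.integral_eq_one n).le) aestronglyMeasurable_const (by simp) hf hq
    (fun u huc hu => by
      simp only [fub _ u (hu.continuous.memLp_of_hasCompactSupport huc), mul_one]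
      exact hρ.tendsto_integral_mul_mollify hfi hu.continuous huc)
  simpa only [fub _ q hq, mul_one] using h

/-- Friedrichs' lemma on commutators of differentiation and mollification, in bilinear form. -/
lemma tendsto_integral_commutator {c f q : V → ℝ} (hc : ContDiff ℝ 1 c)
    (hcc : HasCompactSupport c) (a : V) (hf : MemLp f 2 μ) (hfi : Integrable f μ)
    (hq : MemLp q 2 μ) :
    Tendsto (fun n => ∫ p : V × V, f p.1 * q p.2 *
        ((c p.1 - c p.2) * fderiv ℝ (ρ n) (p.1 - p.2) a) ∂(μ.prod μ)) atTop
      (𝓝 (∫ z, f z * q z * -fderiv ℝ c z a ∂μ)) := by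
  obtain ⟨L, hL⟩ := ContDiff.lipschitzWith_of_hasCompactSupport hcc hc one_ne_zero
  obtain ⟨C, hC⟩ := hρ.moment
  have hdc : Continuous fun z => fderiv ℝ c z a :=
    (hc.continuous_fderiv one_ne_zero).clm_apply continuous_const
  have hdcc : HasCompactSupport fun z => fderiv ℝ c z a := hcc.fderiv_apply ℝ a
  obtain ⟨D, hD⟩ := hdc.bounded_above_of_compact_support hdcc
  have hcL : MemLp c 2 μ := hc.continuous.memLp_of_hasCompactSupport hcc
  -- The Lipschitz bound on `c` compensates the blow-up of ∇ρₙ: the kernel is at most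
  -- L‖a‖·‖y‖‖∇ρₙ(y)‖ with y = p.1 - p.2, whose mass is bounded by the moment condition. It remains
  -- to treat smooth `u`.
  refine tendsto_integral_kernel_of_smooth (μ := μ) (C := L * ‖a‖ * C) (D := D)
    (K := fun n y => L * ‖a‖ * (‖y‖ * ‖fderiv ℝ (ρ n) y‖)) (fun n => ?_) (fun n => ?_)
    (fun n p => ?_) (fun n => ?_) hdc.neg.aestronglyMeasurable (fun z => by simpa using hD z)
    hf hq (fun u huc hu => ?_)
  · have := hρ.continuous_fderiv_apply n a
    have := hc.continuous
    exact (Continuous.mul (by fun_prop) (by fun_prop)).aestronglyMeasurable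
  · refine Integrable.const_mul ?_ _
    have h1 := (hρ.contDiff_one n).continuous_fderiv one_ne_zero
    refine Continuous.integrable_of_hasCompactSupport (by fun_prop) ?_
    exact ((hρ.hasCompactSupport n).fderiv ℝ).norm.mul_left
  · rw [abs_mul]
    have h1 : |c p.1 - c p.2| ≤ L * ‖p.1 - p.2‖ := by
      simpa [Real.dist_eq, dist_eq_norm] using hL.dist_le_mul p.1 p.2
    have h2 : |fderiv ℝ (ρ n) (p.1 - p.2) a| ≤ ‖fderiv ℝ (ρ n) (p.1 - p.2)‖ * ‖a‖ :=
      (fderiv ℝ (ρ n) (p.1 - p.2)).le_opNorm a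
    calc _ ≤ (L * ‖p.1 - p.2‖) * (‖fderiv ℝ (ρ n) (p.1 - p.2)‖ * ‖a‖) := by gcongr
      _ = _ := by ring
  · rw [integral_const_mul]
    exact mul_le_mul_of_nonneg_left (hC n) (by positivity)
  · have hu1 : ContDiff ℝ 1 u := hu.of_le (by norm_cast)
    have hcu1 : ContDiff ℝ 1 (fun z => c z * u z) := hc.mul hu1
    have hcuc : HasCompactSupport fun z => c z * u z := hcc.mul_right
    have hu2 : MemLp u 2 μ := hu.continuous.memLp_of_hasCompactSupport huc
    have hcu2 : MemLp (fun z => c z * u z) 2 μ := hcu1.continuous.memLp_of_hasCompactSupport hcuc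
    obtain ⟨M, hM⟩ := hc.continuous.bounded_above_of_compact_support hcc
    have hdu : Continuous fun z => fderiv ℝ u z a :=
      (hu1.continuous_fderiv one_ne_zero).clm_apply continuous_const
    have hdcu : Continuous fun z => fderiv ℝ (fun y => c y * u y) z a :=
      (hcu1.continuous_fderiv one_ne_zero).clm_apply continuous_const
    have t1 := hρ.tendsto_integral_mul_mollify (hf.integrable_mul hcL) hdu (huc.fderiv_apply ℝ a)
    have t2 := hρ.tendsto_integral_mul_mollify hfi hdcu (hcuc.fderiv_apply ℝ a)
    have hdk : ∀ n, Integrable (fun y => fderiv ℝ (ρ n) y a) μ := fun n =>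
      (hρ.continuous_fderiv_apply n a).integrable_of_hasCompactSupport
        ((hρ.hasCompactSupport n).fderiv_apply ℝ a)
    -- For smooth `u` the derivative is moved from ρₙ onto `u` and `c u`; the form becomes ∫ f c (ρₙ
    -- ∗ ∂u) - ∫ f (ρₙ ∗ ∂(cu)), with limit ∫ f (c ∂u - ∂(cu)) = -∫ f u ∂c.
    have e : ∫ z, f z * u z * -fderiv ℝ c z a ∂μ = ∫ z, (f * c) z * fderiv ℝ u z a ∂μ -
        ∫ z, f z * fderiv ℝ (fun y => c y * u y) z a ∂μ := by
      obtain ⟨M1, hM1⟩ := hdu.bounded_above_of_compact_support (huc.fderiv_apply ℝ a)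
      obtain ⟨M2, hM2⟩ := hdcu.bounded_above_of_compact_support (hcuc.fderiv_apply ℝ a)
      rw [← integral_sub ((hf.integrable_mul hcL).mul_bdd hdu.aestronglyMeasurable
        (Eventually.of_forall hM1)) (hfi.mul_bdd hdcu.aestronglyMeasurable
        (Eventually.of_forall hM2))]
      refine integral_congr_ae (Eventually.of_forall fun z => ?_)
      simp only [Pi.mul_apply]
      rw [fderiv_fun_mul (hc.differentiable one_ne_zero z) (hu1.differentiable one_ne_zero z)]
      simp only [add_apply, smul_apply, smul_eq_mul]
      ring
    rw [e]
    refine (t1.sub t2).congr fun n => ?_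
    obtain ⟨i1, i2, i3⟩ := integral_mul_mollify hc.continuous hM
      (hρ.continuous_fderiv_apply n a) (hdk n) hf hu2
    obtain ⟨j1, j2, j3⟩ := integral_mul_mollify (μ := μ) (c := fun _ => 1) (M := 1)
      continuous_const (by simp) (hρ.continuous_fderiv_apply n a) (hdk n) hf hcu2
    have l1 : ∫ z, (f * c) z * mollify μ (ρ n) (fun z => fderiv ℝ u z a) z ∂μ =
        ∫ z, f z * (c z * mollify μ (fun y => fderiv ℝ (ρ n) y a) u z) ∂μ := by
      refine integral_congr_ae (Eventually.of_forall fun z => ?_)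
      simp only [Pi.mul_apply]
      rw [← fderiv_mollify_right (hρ.integrable n).locallyIntegrable hu1 huc,
        fderiv_mollify (hρ.contDiff_one n) (hρ.hasCompactSupport n)
          hu.continuous.locallyIntegrable, mul_assoc]
    have l2 : ∫ z, f z * mollify μ (ρ n) (fun z => fderiv ℝ (fun y => c y * u y) z a) z ∂μ =
        ∫ z, f z * (1 * mollify μ (fun y => fderiv ℝ (ρ n) y a) (fun y => c y * u y) z) ∂μ := by
      refine integral_congr_ae (Eventually.of_forall fun z => ?_)
      simp only [one_mul]
      rw [← fderiv_mollify_right (hρ.integrable n).locallyIntegrable hcu1 hcuc,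
        fderiv_mollify (hρ.contDiff_one n) (hρ.hasCompactSupport n)
          hcu1.continuous.locallyIntegrable]
    rw [l1, l2, ← i3, ← j3, ← integral_sub i1 j1]
    refine integral_congr_ae (Eventually.of_forall fun p => ?_)
    simp only
    ring

/-- Swapping the two variables in the second integral and using that ∇ρₙ is odd turns the sum into
the commutator form with kernel (c(x) - c(y)) ∂ρₙ(x - y). Neither integral need converge alone. -/
lemma tendsto_integral_mul_fderiv_mollify {c f q : V → ℝ} (hc : ContDiff ℝ 1 c)
    (hcc : HasCompactSupport c) (a : V) (hf : MemLp f 2 μ) (hfi : Integrable f μ)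
    (hq : MemLp q 2 μ) (hqi : Integrable q μ) :
    (∀ n, Integrable (fun z => f z * (c z * fderiv ℝ (mollify μ (ρ n) q) z a)) μ) ∧
    Tendsto (fun n => ∫ z, f z * (c z * fderiv ℝ (mollify μ (ρ n) q) z a) ∂μ +
        ∫ z, q z * (c z * fderiv ℝ (mollify μ (ρ n) f) z a) ∂μ) atTop
      (𝓝 (∫ z, f z * q z * -fderiv ℝ c z a ∂μ)) := by
  obtain ⟨M, hM⟩ := hc.continuous.bounded_above_of_compact_support hcc
  have hdk : ∀ n, Integrable (fun y => fderiv ℝ (ρ n) y a) μ := fun n =>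
    (hρ.continuous_fderiv_apply n a).integrable_of_hasCompactSupport
      ((hρ.hasCompactSupport n).fderiv_apply ℝ a)
  have dm : ∀ n, ∀ u : V → ℝ, Integrable u μ → ∀ z, fderiv ℝ (mollify μ (ρ n) u) z a =
      mollify μ (fun y => fderiv ℝ (ρ n) y a) u z := fun n u hu z =>
    fderiv_mollify (hρ.contDiff_one n) (hρ.hasCompactSupport n) hu.locallyIntegrable z a
  have I := fun n => integral_mul_mollify hc.continuous hM
    (hρ.continuous_fderiv_apply n a) (hdk n) hf hq
  have J := fun n => integral_mul_mollify hc.continuous hM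
    (hρ.continuous_fderiv_apply n a) (hdk n) hq hf
  simp only [fun n z => dm n q hqi z, fun n z => dm n f hfi z]
  refine ⟨fun n => (I n).2.1, ?_⟩
  refine (hρ.tendsto_integral_commutator hc hcc a hf hfi hq).congr fun n => ?_
  obtain ⟨i1, -, i3⟩ := I n
  obtain ⟨j1, -, j3⟩ := J n
  rw [← i3, ← j3, ← integral_prod_swap (fun p : V × V => q p.1 * f p.2 *
    (c p.1 * fderiv ℝ (ρ n) (p.1 - p.2) a))]
  refine Eq.trans ?_ (integral_add i1 j1.swap)
  refine integral_congr_ae (Eventually.of_forall fun p => ?_)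
  simp only [Prod.fst_swap, Prod.snd_swap]
  rw [← neg_sub p.1 p.2, hρ.fderiv_neg]
  ring

end IsMollifier

/-- The derivative of `h` along the Hamiltonian vector field of `E`, in terms of a family of
conjugate directions. -/
noncomputable def hamiltonianDeriv {ι : Type*} [Fintype ι] (a b : ι → V) (E h : V → ℝ) (z : V) :
    ℝ :=
  ∑ i, (fderiv ℝ E z (b i) * fderiv ℝ h z (a i) - fderiv ℝ E z (a i) * fderiv ℝ h z (b i))

omit [FiniteDimensional ℝ V] [MeasurableSpace V] [BorelSpace V] in
lemma fderiv_fderiv_apply_comm {E : V → ℝ} (hE : ContDiff ℝ 2 E) (z v w : V) :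
    fderiv ℝ (fun y => fderiv ℝ E y v) z w = fderiv ℝ (fun y => fderiv ℝ E y w) z v := by
  have hE1 : ContDiff ℝ 1 (fderiv ℝ E) := hE.fderiv_right (by norm_num)
  have hd := (hE1.differentiable one_ne_zero) z
  rw [fderiv_clm_apply hd (differentiableAt_const v),
    fderiv_clm_apply hd (differentiableAt_const w)]
  have := (hE.contDiffAt (x := z)).isSymmSndFDerivAt (by simp) v w
  simpa using this.symm

/-- Commutators of mollification and Hamiltonian vector fields vanish in the limit. -/
lemma IsMollifier.tendsto_integral_hamiltonianDeriv {ρ : ℕ → V → ℝ} (hρ : IsMollifier μ ρ)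
    {ι : Type*} [Fintype ι] (a b : ι → V) {E f q : V → ℝ} (hE : ContDiff ℝ 2 E)
    (hEc : HasCompactSupport E) (hf : MemLp f 2 μ) (hfi : Integrable f μ)
    (hq : MemLp q 2 μ) (hqi : Integrable q μ) :
    Tendsto (fun n => ∫ z, f z * hamiltonianDeriv a b E (mollify μ (ρ n) q) z ∂μ +
        ∫ z, q z * hamiltonianDeriv a b E (mollify μ (ρ n) f) z ∂μ) atTop (𝓝 0) := by
  have hE1 : ContDiff ℝ 1 (fderiv ℝ E) := hE.fderiv_right (by norm_num)
  have hc : ∀ v, ContDiff ℝ 1 fun z => fderiv ℝ E z v := fun v => hE1.clm_apply contDiff_const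
  have hcc : ∀ v, HasCompactSupport fun z => fderiv ℝ E z v := fun v => hEc.fderiv_apply ℝ v
  have T := fun v w => hρ.tendsto_integral_mul_fderiv_mollify (hc v) (hcc v) w hf hfi hq hqi
  have T' := fun v w => hρ.tendsto_integral_mul_fderiv_mollify (hc v) (hcc v) w hq hqi hf hfi
  have lim := tendsto_finsetSum Finset.univ
    fun i (_ : i ∈ Finset.univ) => (T (b i) (a i)).2.sub (T (a i) (b i)).2
  -- The limit is ∫ f q times minus the divergence of the Hamiltonian vector field, which vanishes
  -- by symmetry of second derivatives.
  simp only [fun z i => fderiv_fderiv_apply_comm hE z (b i) (a i), sub_self,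
    Finset.sum_const_zero] at lim
  refine lim.congr fun n => ?_
  have expand : ∀ u h : V → ℝ,
      (∀ v w, Integrable (fun z => u z * (fderiv ℝ E z v * fderiv ℝ h z w)) μ) →
      ∫ z, u z * hamiltonianDeriv a b E h z ∂μ =
        ∑ i, (∫ z, u z * (fderiv ℝ E z (b i) * fderiv ℝ h z (a i)) ∂μ -
          ∫ z, u z * (fderiv ℝ E z (a i) * fderiv ℝ h z (b i)) ∂μ) := by
    intro u h hi
    simp only [hamiltonianDeriv, Finset.mul_sum, mul_sub]
    refine (integral_finsetSum _ fun i _ => (hi (b i) (a i)).sub (hi (a i) (b i))).trans ?_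
    exact Finset.sum_congr rfl fun i _ => integral_sub (hi _ _) (hi _ _)
  rw [expand _ _ fun v w => (T v w).1 n, expand _ _ fun v w => (T' v w).1 n,
    ← Finset.sum_add_distrib]
  exact Finset.sum_congr rfl fun i _ => by ring

end Mollifier

/-! ### Construction of mollifiers by scaling -/

section Mollifier

variable {V : Type*} [NormedAddCommGroup V] [NormedSpace ℝ V] [FiniteDimensional ℝ V]
  [MeasurableSpace V] [BorelSpace V] {μ : Measure V} [μ.IsAddHaarMeasure]

/-- The approximate identity obtained from `β` by normalization and scaling. -/
noncomputable def rescaledBump (μ : Measure V) (β : V → ℝ) (n : ℕ) (z : V) : ℝ :=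
  (∫ y, β y ∂μ)⁻¹ * ((n : ℝ) + 1) ^ Module.finrank ℝ V * β (((n : ℝ) + 1) • z)

/-- The first moment of the gradient is scale invariant: the factor n + 1 from differentiation is
absorbed by ‖z‖, and the power of n + 1 by the Jacobian. The condition β 0 ≠ 0 makes the normalizing
integral positive. -/
lemma isMollifier_rescaledBump {β : V → ℝ} (hβ : ContDiff ℝ ∞ β) (hβ0 : ∀ z, 0 ≤ β z)
    (hpos : β 0 ≠ 0) (heven : ∀ z, β (-z) = β z) (hsupp : ∀ z, 1 < ‖z‖ → β z = 0) :
    IsMollifier μ (rescaledBump μ β) := by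
  have hc : HasCompactSupport β := HasCompactSupport.intro (isCompact_closedBall 0 1)
    fun z hz => hsupp z (by simpa using hz)
  have hI : 0 < ∫ y, β y ∂μ :=
    hβ.continuous.integral_pos_of_hasCompactSupport_nonneg_nonzero hc hβ0 hpos
  have hn : ∀ n : ℕ, (0 : ℝ) < (n : ℝ) + 1 := fun n => by positivity
  have hscale : ∀ (n : ℕ) (F : V → ℝ), ((n : ℝ) + 1) ^ Module.finrank ℝ V *
      ∫ z, F (((n : ℝ) + 1) • z) ∂μ = ∫ z, F z ∂μ := fun n F => by
    have := hn n
    rw [Measure.integral_comp_smul, abs_of_pos (by positivity), smul_eq_mul,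
      mul_inv_cancel_left₀ (by positivity)]
  refine ⟨fun n => ?_, fun n z => ?_, fun n z => ?_, fun n => ?_, fun n z hz => ?_,
    ⟨(∫ y, β y ∂μ)⁻¹ * ∫ z, ‖z‖ * ‖fderiv ℝ β z‖ ∂μ, fun n => ?_⟩⟩
  · exact contDiff_const.mul (hβ.comp (contDiff_const_smul _))
  · have := hn n
    have := hβ0 (((n : ℝ) + 1) • z)
    unfold rescaledBump
    positivity
  · simp only [rescaledBump, smul_neg, heven]
  · simp only [rescaledBump]
    rw [integral_const_mul, mul_assoc, hscale n β, inv_mul_cancel₀ hI.ne']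
  · rw [rescaledBump, hsupp, mul_zero]
    rw [norm_smul, Real.norm_of_nonneg (hn n).le]
    rwa [div_lt_iff₀' (hn n)] at hz
  · refine le_of_eq ?_
    have h1 : ∀ z, ‖z‖ * ‖fderiv ℝ (rescaledBump μ β n) z‖ =
        (∫ y, β y ∂μ)⁻¹ * ((n : ℝ) + 1) ^ Module.finrank ℝ V *
          (‖((n : ℝ) + 1) • z‖ * ‖fderiv ℝ β (((n : ℝ) + 1) • z)‖) := fun z => by
      have hd : HasFDerivAt (rescaledBump μ β n)
          (((∫ y, β y ∂μ)⁻¹ * ((n : ℝ) + 1) ^ Module.finrank ℝ V) •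
            ((fderiv ℝ β (((n : ℝ) + 1) • z)).comp
              (((n : ℝ) + 1) • ContinuousLinearMap.id ℝ V))) z :=
        ((hβ.differentiable (by simp) _).hasFDerivAt.comp z
          ((hasFDerivAt_id z).const_smul ((n : ℝ) + 1))).const_mul _
      have := hn n
      rw [hd.fderiv, norm_smul, ContinuousLinearMap.comp_smul, ContinuousLinearMap.comp_id,
        norm_smul, norm_smul, Real.norm_of_nonneg (hn n).le, Real.norm_of_nonneg (by positivity)]
      ring
    simp only [h1]
    rw [integral_const_mul, mul_assoc, hscale n fun z => ‖z‖ * ‖fderiv ℝ β z‖]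

end Mollifier

/-! ### Rotation-invariant mollification on phase space -/

/-- A smooth bump function on phase space which is invariant under rotations. -/
noncomputable def sphericalBump (z : Phase) : ℝ :=
  Real.smoothTransition (1 - (‖z.1‖ ^ 2 + ‖z.2‖ ^ 2))

/-- A rotationally invariant approximate identity on phase space. -/
noncomputable def sphericalMollifier : ℕ → Phase → ℝ := rescaledBump volume sphericalBump

instance : (volume : Measure Phase).IsAddHaarMeasure :=
  inferInstanceAs ((volume : Measure E3).prod (volume : Measure E3)).IsAddHaarMeasure

lemma isMollifier_sphericalMollifier : IsMollifier volume sphericalMollifier := by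
  refine isMollifier_rescaledBump ?_ (fun z => Real.smoothTransition.nonneg _) ?_ (fun z => ?_)
    (fun z hz => ?_)
  · refine Real.smoothTransition.contDiff.comp (contDiff_const.sub ?_)
    exact ((contDiff_norm_sq ℝ).comp contDiff_fst).add ((contDiff_norm_sq ℝ).comp contDiff_snd)
  · simp [sphericalBump]
  · simp [sphericalBump]
  · refine Real.smoothTransition.zero_of_nonpos ?_
    -- The norm on `Phase` is the maximum of the two Euclidean norms, whereas the bump is built from
    -- the sum of squares, which is smooth.
    rcases lt_max_iff.1 (show 1 < max ‖z.1‖ ‖z.2‖ from hz) with h | h <;>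
      nlinarith [sq_nonneg ‖z.1‖, sq_nonneg ‖z.2‖]

lemma sphericalMollifier_rotate (A : E3 ≃ₗᵢ[ℝ] E3) (n : ℕ) (z : Phase) :
    sphericalMollifier n (rotate A z) = sphericalMollifier n z := by
  simp [sphericalMollifier, rescaledBump, sphericalBump, rotate, norm_smul]

/-- Mollification on phase space preserving spherical symmetry. -/
noncomputable abbrev smoothen (n : ℕ) (u : Phase → ℝ) : Phase → ℝ :=
  mollify volume (sphericalMollifier n) u

/-- Kernel and Lebesgue measure are rotation invariant, so the convolution integral may be rotated.
-/
lemma IsSphericallySymmetric.smoothen {u : Phase → ℝ} (hu : IsSphericallySymmetric u) (n : ℕ) :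
    IsSphericallySymmetric (smoothen n u) := by
  intro A hA
  refine Eventually.of_forall fun z => ?_
  have hm := IsotropicSteadyState.measurePreserving_rotate A
  have he : MeasurableEmbedding (rotate A) :=
    (A.toHomeomorph.prodCongr A.toHomeomorph).measurableEmbedding
  rw [_root_.smoothen, mollify_apply, mollify_apply, ← hm.integral_comp he]
  refine integral_congr_ae ?_
  filter_upwards [hu A hA] with t ht
  have h : rotate A z - rotate A t = rotate A (z - t) := by simp [rotate]
  simp only [ht, h, sphericalMollifier_rotate]

/-- The coordinate directions in position space. -/
noncomputable def posDir (i : Fin 3) : Phase := (EuclideanSpace.basisFun (Fin 3) ℝ i, 0)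

/-- The coordinate directions in velocity space. -/
noncomputable def velDir (i : Fin 3) : Phase := (0, EuclideanSpace.basisFun (Fin 3) ℝ i)

/-- Expanding the inner products in the standard basis brings the bracket into the form covered by
the commutator lemma. -/
lemma poissonBracket_eq {E h : Phase → ℝ} (hE : ContDiff ℝ 1 E) (hh : ContDiff ℝ 1 h)
    (z : Phase) : poissonBracket h E z = hamiltonianDeriv posDir velDir E h z := by
  rw [poissonBracket, hamiltonianDeriv, Finset.sum_sub_distrib,
    ← (EuclideanSpace.basisFun (Fin 3) ℝ).sum_inner_mul_inner,
    ← (EuclideanSpace.basisFun (Fin 3) ℝ).sum_inner_mul_inner]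
  simp only [IsotropicSteadyState.gradX_eq hE, IsotropicSteadyState.gradV_eq hE,
    IsotropicSteadyState.gradX_eq hh, IsotropicSteadyState.gradV_eq hh, InnerProductSpace.toDual_symm_apply,
    real_inner_comm _ (EuclideanSpace.basisFun (Fin 3) ℝ _)]
  rfl

lemma gradX_congr {f g : Phase → ℝ} {z : Phase} (h : f =ᶠ[𝓝 z] g) : gradX f z = gradX g z := by
  have : (fun x : E3 => f (x, z.2)) =ᶠ[𝓝 z.1] fun x => g (x, z.2) :=
    (Continuous.tendsto' (by fun_prop) z.1 z rfl : Tendsto (fun x : E3 => (x, z.2)) _ _).eventually h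
  rw [gradX, gradX, gradient, gradient, this.fderiv_eq]

lemma gradV_congr {f g : Phase → ℝ} {z : Phase} (h : f =ᶠ[𝓝 z] g) : gradV f z = gradV g z := by
  have : (fun v : E3 => f (z.1, v)) =ᶠ[𝓝 z.2] fun v => g (z.1, v) :=
    (Continuous.tendsto' (by fun_prop) z.2 z rfl : Tendsto (fun v : E3 => (z.1, v)) _ _).eventually h
  rw [gradV, gradV, gradient, gradient, this.fderiv_eq]

lemma poissonBracket_congr_right {f E E' : Phase → ℝ} {z : Phase} (h : E =ᶠ[𝓝 z] E') :
    poissonBracket f E z = poissonBracket f E' z := by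
  rw [poissonBracket, poissonBracket, gradX_congr h, gradV_congr h]

lemma integrable_of_memLp_of_eq_zero {u : Phase → ℝ} {K : Set Phase} (hK : IsCompact K)
    (hu : MemLp u 2) (h0 : ∀ z ∉ K, u z = 0) : Integrable u := by
  have h1 : IntegrableOn u K :=
    (hu.locallyIntegrable (by norm_num)).integrableOn_isCompact hK
  exact (integrableOn_iff_integrable_of_support_subset fun z hz => by
    by_contra h
    exact hz (h0 z h)).1 h1

/-- The weak transport relation (with respect to Lebesgue measure, on all of phase space) is skew
symmetric on compactly supported square integrable functions. -/
lemma integral_add_integral_eq_zero_of_weak {E f g q p : Phase → ℝ} {K : Set Phase}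
    (hE : ContDiff ℝ 2 E) (hK : IsCompact K)
    (hf : MemLp f 2) (hg : MemLp g 2) (hq : MemLp q 2) (hp : MemLp p 2)
    (hf0 : ∀ z ∉ K, f z = 0) (hg0 : ∀ z ∉ K, g z = 0) (hq0 : ∀ z ∉ K, q z = 0)
    (hfs : IsSphericallySymmetric f) (hqs : IsSphericallySymmetric q)
    (hfg : ∀ ξ : Phase → ℝ, ContDiff ℝ ∞ ξ → HasCompactSupport ξ → IsSphericallySymmetric ξ →
      ∫ z, f z * poissonBracket ξ E z = -∫ z, g z * ξ z)
    (hqp : ∀ ξ : Phase → ℝ, ContDiff ℝ ∞ ξ → HasCompactSupport ξ → IsSphericallySymmetric ξ →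
      ∫ z, q z * poissonBracket ξ E z = -∫ z, p z * ξ z) :
    (∫ z, f z * p z) + ∫ z, g z * q z = 0 := by
  have hρ := isMollifier_sphericalMollifier
  have hfi := integrable_of_memLp_of_eq_zero hK hf hf0
  have hgi := integrable_of_memLp_of_eq_zero hK hg hg0
  have hqi := integrable_of_memLp_of_eq_zero hK hq hq0
  obtain ⟨R, hR⟩ := hK.isBounded.subset_ball (0 : Phase)
  -- The commutator lemma wants a compactly supported Hamiltonian. Cutting off `E` outside a ball
  -- containing `K` leaves it unchanged near `K`, where `f` and `q` live; `max R 1` keeps the inner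
  -- radius positive.
  let χ : ContDiffBump (0 : Phase) := ⟨max R 1, max R 1 + 1, by positivity, by linarith⟩
  set E' : Phase → ℝ := fun z => χ z * E z
  have hE' : ContDiff ℝ 2 E' := χ.contDiff.mul hE
  have hE'c : HasCompactSupport E' := χ.hasCompactSupport.mul_right
  have hEE' : ∀ z ∈ K, E' =ᶠ[𝓝 z] E := fun z hz => by
    filter_upwards [Metric.isOpen_ball.mem_nhds (hR hz)] with y hy
    simp only [E']
    rw [χ.one_of_mem_closedBall, one_mul]
    exact Metric.ball_subset_closedBall.trans (Metric.closedBall_subset_closedBall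
      (le_max_left R 1)) hy
  have hcs : ∀ n (u : Phase → ℝ), (∀ z ∉ K, u z = 0) →
      HasCompactSupport (smoothen n u) := fun n u hu =>
    HasCompactSupport.convolution _ (HasCompactSupport.intro hK hu) (hρ.hasCompactSupport n)
  have hsm : ∀ n (u : Phase → ℝ), Integrable u → ContDiff ℝ ∞ (smoothen n u) := fun n u hu =>
    contDiff_mollify (hρ.smooth n) (hρ.hasCompactSupport n) hu.locallyIntegrable
  have rew : ∀ u h : Phase → ℝ, (∀ z ∉ K, u z = 0) → ContDiff ℝ ∞ h →
      ∫ z, u z * hamiltonianDeriv posDir velDir E' h z = ∫ z, u z * poissonBracket h E z := by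
    intro u h hu hh
    refine integral_congr_ae (Eventually.of_forall fun z => ?_)
    by_cases hz : z ∈ K
    · simp only
      rw [← poissonBracket_eq (hE'.of_le one_le_two) (hh.of_le (by norm_cast)),
        poissonBracket_congr_right (hEE' z hz)]
    · simp only [hu z hz, zero_mul]
  have t1 := hρ.tendsto_integral_hamiltonianDeriv posDir velDir hE' hE'c hf hfi hq hqi
  have t2 := (hρ.tendsto_integral_mul_mollify_of_memLp hg hgi hq).add
    (hρ.tendsto_integral_mul_mollify_of_memLp hf hfi hp)
  -- The first relation is tested with mollified `q`, the second with mollified `f`; symmetry of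
  -- mollification then moves it from `f` to `p`. Comparing the limit 0 of the transport terms with
  -- that of the right-hand sides gives the claim.
  have t3 := t1.congr' (f₂ := fun n => -((∫ z, g z * mollify volume (sphericalMollifier n) q z) +
    ∫ z, f z * mollify volume (sphericalMollifier n) p z)) (Eventually.of_forall fun n => by
      simp only
      rw [rew f _ hf0 (hsm n q hqi), rew q _ hq0 (hsm n f hfi),
        hfg _ (hsm n q hqi) (hcs n q hq0) (hqs.smoothen n),
        hqp _ (hsm n f hfi) (hcs n f hf0) (hfs.smoothen n),
        hρ.integral_mul_mollify_comm hf hp]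
      ring)
  have := tendsto_nhds_unique t2.neg t3
  linarith

/-! ### Poisson brackets -/

lemma inner_gradX {f : Phase → ℝ} (hf : ContDiff ℝ 1 f) (z : Phase) (w : E3) :
    inner ℝ (gradX f z) w = fderiv ℝ f z (w, 0) := by
  rw [IsotropicSteadyState.gradX_eq hf, InnerProductSpace.toDual_symm_apply]
  rfl

lemma inner_gradV {f : Phase → ℝ} (hf : ContDiff ℝ 1 f) (z : Phase) (w : E3) :
    inner ℝ (gradV f z) w = fderiv ℝ f z (0, w) := by
  rw [IsotropicSteadyState.gradV_eq hf, InnerProductSpace.toDual_symm_apply]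
  rfl

lemma fderiv_rotate {f : Phase → ℝ} (hf : ContDiff ℝ 1 f) {A : E3 ≃ₗᵢ[ℝ] E3}
    (hA : ∀ z, f (rotate A z) = f z) (z w : Phase) :
    fderiv ℝ f (rotate A z) (rotate A w) = fderiv ℝ f z w := by
  let L : Phase →L[ℝ] Phase :=
    (A.toContinuousLinearEquiv : E3 →L[ℝ] E3).prodMap (A.toContinuousLinearEquiv : E3 →L[ℝ] E3)
  have h1 : HasFDerivAt f (fderiv ℝ f (L z)) (L z) :=
    (hf.differentiable one_ne_zero _).hasFDerivAt
  have h2 := h1.comp z L.hasFDerivAt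
  rw [show f ∘ L = f from funext hA] at h2
  rw [h2.fderiv]
  rfl

lemma gradX_rotate {f : Phase → ℝ} (hf : ContDiff ℝ 1 f) {A : E3 ≃ₗᵢ[ℝ] E3}
    (hA : ∀ z, f (rotate A z) = f z) (z : Phase) : gradX f (rotate A z) = A (gradX f z) := by
  refine ext_inner_right ℝ fun w => ?_
  obtain ⟨w, rfl⟩ := A.surjective w
  rw [A.inner_map_map, inner_gradX hf, inner_gradX hf, ← fderiv_rotate hf hA z]
  simp [rotate]

lemma gradV_rotate {f : Phase → ℝ} (hf : ContDiff ℝ 1 f) {A : E3 ≃ₗᵢ[ℝ] E3}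
    (hA : ∀ z, f (rotate A z) = f z) (z : Phase) : gradV f (rotate A z) = A (gradV f z) := by
  refine ext_inner_right ℝ fun w => ?_
  obtain ⟨w, rfl⟩ := A.surjective w
  rw [A.inner_map_map, inner_gradV hf, inner_gradV hf, ← fderiv_rotate hf hA z]
  simp [rotate]

/-- Lebesgue measure charges every nonempty open set, so continuous functions that agree almost
everywhere agree everywhere. -/
lemma IsSphericallySymmetric.eq_of_continuous {f : Phase → ℝ} (hf : IsSphericallySymmetric f)
    (hc : Continuous f) {A : E3 ≃ₗᵢ[ℝ] E3} (hA : IsRotation A) (z : Phase) :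
    f (rotate A z) = f z := by
  have hr : Continuous (rotate A) := by
    unfold rotate
    exact (A.continuous.comp continuous_fst).prodMk (A.continuous.comp continuous_snd)
  exact congrFun ((hc.comp hr).ae_eq_iff_eq volume hc |>.1 (hf A hA)) z

lemma poissonBracket_mul {E f g : Phase → ℝ} (hE : ContDiff ℝ 1 E) (hf : ContDiff ℝ 1 f)
    (hg : ContDiff ℝ 1 g) (z : Phase) :
    poissonBracket (fun y => f y * g y) E z =
      f z * poissonBracket g E z + g z * poissonBracket f E z := by
  rw [poissonBracket_eq hE (hf.mul hg), poissonBracket_eq hE hf, poissonBracket_eq hE hg,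
    hamiltonianDeriv, hamiltonianDeriv, hamiltonianDeriv, Finset.mul_sum, Finset.mul_sum,
    ← Finset.sum_add_distrib]
  refine Finset.sum_congr rfl fun i _ => ?_
  rw [fderiv_fun_mul (hf.differentiable one_ne_zero z) (hg.differentiable one_ne_zero z)]
  simp only [add_apply, smul_apply, smul_eq_mul]
  ring

lemma poissonBracket_comp_self {E : Phase → ℝ} {θ : ℝ → ℝ} (hE : ContDiff ℝ 1 E)
    (hθ : ContDiff ℝ 1 θ) (z : Phase) : poissonBracket (fun y => θ (E y)) E z = 0 := by
  rw [poissonBracket_eq (h := fun y => θ (E y)) hE (hθ.comp hE), hamiltonianDeriv]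
  refine Finset.sum_eq_zero fun i _ => ?_
  have h := ((hθ.differentiable one_ne_zero (E z)).hasDerivAt.comp_hasFDerivAt z
    (hE.differentiable one_ne_zero z).hasFDerivAt)
  rw [show (fun y => θ (E y)) = θ ∘ E from rfl, h.fderiv]
  simp only [smul_apply, smul_eq_mul]
  ring

/-- Functions of the energy are constants of motion. This identity is what permits localization in
energy and insertion of polynomials in E. -/
lemma poissonBracket_comp_mul {E f : Phase → ℝ} {θ : ℝ → ℝ} (hE : ContDiff ℝ 1 E)
    (hθ : ContDiff ℝ 1 θ) (hf : ContDiff ℝ 1 f) (z : Phase) :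
    poissonBracket (fun y => θ (E y) * f y) E z = θ (E z) * poissonBracket f E z := by
  rw [poissonBracket_mul (f := fun y => θ (E y)) hE (hθ.comp hE) hf,
    poissonBracket_comp_self hE hθ, mul_zero, add_zero]

/-- Liouville's theorem in integrated form. -/
lemma integral_poissonBracket {E u : Phase → ℝ} (hE : ContDiff ℝ 2 E) (hu : ContDiff ℝ 1 u)
    (huc : HasCompactSupport u) : ∫ z, poissonBracket u E z = 0 := by
  have hE1 : ContDiff ℝ 1 (fderiv ℝ E) := hE.fderiv_right (by norm_num)
  have hc : ∀ v, ContDiff ℝ 1 fun z => fderiv ℝ E z v := fun v => hE1.clm_apply contDiff_const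
  have hu' : ∀ v, Continuous fun z => fderiv ℝ u z v := fun v =>
    (hu.continuous_fderiv one_ne_zero).clm_apply continuous_const
  have hi : ∀ v w, Integrable fun z => fderiv ℝ E z v * fderiv ℝ u z w := fun v w =>
    ((hc v).continuous.mul (hu' w)).integrable_of_hasCompactSupport (huc.fderiv_apply ℝ w).mul_left
  have hj : ∀ v w, Integrable fun z => fderiv ℝ (fun y => fderiv ℝ E y v) z w * u z := fun v w =>
    ((((hc v).continuous_fderiv one_ne_zero).clm_apply continuous_const).mul
      hu.continuous).integrable_of_hasCompactSupport huc.mul_left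
  have ibp : ∀ v w, ∫ z, fderiv ℝ E z v * fderiv ℝ u z w =
      -∫ z, fderiv ℝ (fun y => fderiv ℝ E y v) z w * u z := fun v w =>
    integral_mul_fderiv_eq_neg_fderiv_mul_of_integrable (hj v w) (hi v w)
      (((hc v).continuous.mul hu.continuous).integrable_of_hasCompactSupport huc.mul_left)
      (fun z _ => (hc v).differentiable one_ne_zero z) fun z _ => hu.differentiable one_ne_zero z
  simp only [poissonBracket_eq (hE.of_le one_le_two) hu, hamiltonianDeriv]
  refine (integral_finsetSum _ fun i _ => (hi (velDir i) (posDir i)).sub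
    (hi (posDir i) (velDir i))).trans ?_
  refine Finset.sum_eq_zero fun i _ => ?_
  simp only [Pi.sub_apply]
  rw [integral_sub (hi _ _) (hi _ _), ibp, ibp]
  simp only [fun z => fderiv_fderiv_apply_comm hE z (posDir i) (velDir i), sub_self]

/-- Testing with the mollifications of `u` itself gives ∫ u² = 0 in the limit. -/
lemma ae_eq_zero_of_integral_mul_smooth_eq_zero {u : Phase → ℝ} {K : Set Phase}
    (hK : IsCompact K) (hu : MemLp u 2) (hu0 : ∀ z ∉ K, u z = 0) (hus : IsSphericallySymmetric u)
    (h : ∀ ξ : Phase → ℝ, ContDiff ℝ ∞ ξ → HasCompactSupport ξ → IsSphericallySymmetric ξ →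
      ∫ z, u z * ξ z = 0) : u =ᵐ[volume] 0 := by
  have hρ := isMollifier_sphericalMollifier
  have hui := integrable_of_memLp_of_eq_zero hK hu hu0
  have t := hρ.tendsto_integral_mul_mollify_of_memLp hu hui hu
  have h0 : ∀ n, ∫ z, u z * mollify volume (sphericalMollifier n) u z = 0 := fun n =>
    h _ (contDiff_mollify (hρ.smooth n) (hρ.hasCompactSupport n) hui.locallyIntegrable)
      (HasCompactSupport.convolution _ (HasCompactSupport.intro hK hu0) (hρ.hasCompactSupport n))
      (hus.smoothen n)
  simp only [h0] at t
  have h1 := tendsto_nhds_unique t tendsto_const_nhds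
  have h2 : ∫ z, u z ^ 2 = 0 := by simpa only [sq] using h1
  rw [integral_eq_zero_iff_of_nonneg (fun z => sq_nonneg _) hu.integrable_sq] at h2
  filter_upwards [h2] with z hz
  simpa using hz

namespace IsotropicSteadyState

variable (s : IsotropicSteadyState)

/-! ### Compactness of energy sublevel sets -/

/-- The cutoff energy lies strictly below the limit at infinity of the energy of a particle at rest
(0, respectively 1), which bounds the position. On the resulting ball the potential is bounded
below, which bounds the velocity. -/
lemma isCompact_sublevel {e : ℝ} (he : e < s.E₀) : IsCompact {z | s.E z ≤ e} := by
  refine Metric.isCompact_of_isClosed_isBounded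
    (isClosed_le s.contDiff_E.continuous continuous_const) ?_
  rcases s.isSteadyState with ⟨U, h, hE⟩ | ⟨l, m, h, hE⟩
  · obtain ⟨R, hR⟩ := eventually_atTop.1 (h.tendsto_zero.eventually (lt_mem_nhds h.cutoff_neg))
    obtain ⟨b, hb⟩ := ((isCompact_closedBall (0 : E3) R).bddBelow_image
      h.regular.2.continuous.continuousOn)
    refine (Metric.isBounded_closedBall (x := (0 : Phase))
      (r := max R (2 * (e - b) + 1))).subset fun z hz => ?_
    have hz' : ‖z.2‖ ^ 2 / 2 + U ‖z.1‖ ≤ e := by simpa [hE, newtonianEnergy] using hz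
    have h1 : ‖z.1‖ ≤ R := by
      by_contra! hlt
      have := hR _ hlt.le
      nlinarith [sq_nonneg ‖z.2‖]
    have h2 : b ≤ U ‖z.1‖ := hb ⟨z.1, by simpa using h1, rfl⟩
    rw [mem_closedBall_zero_iff]
    refine max_le_max h1 ?_
    nlinarith [sq_nonneg (‖z.2‖ - 1)]
  · have hexp : Tendsto (fun r => Real.exp (m r)) atTop (𝓝 1) := by
      simpa [Function.comp_def] using (Real.continuous_exp.tendsto 0).comp h.mu_tendsto_zero
    obtain ⟨R, hR⟩ := eventually_atTop.1 (hexp.eventually (lt_mem_nhds h.cutoff_lt_one))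
    obtain ⟨b, hb⟩ := ((isCompact_closedBall (0 : E3) R).bddBelow_image
      h.regular_mu.2.continuous.continuousOn)
    refine (Metric.isBounded_closedBall (x := (0 : Phase))
      (r := max R (e / Real.exp b))).subset fun z hz => ?_
    have hz' : Real.exp (m ‖z.1‖) * √(1 + ‖z.2‖ ^ 2) ≤ e := by
      simpa [hE, relativisticEnergy] using hz
    have hone : 1 ≤ √(1 + ‖z.2‖ ^ 2) := Real.one_le_sqrt.2 (by nlinarith [sq_nonneg ‖z.2‖])
    have h1 : ‖z.1‖ ≤ R := by
      by_contra! hlt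
      have := hR _ hlt.le
      nlinarith [Real.exp_pos (m ‖z.1‖)]
    have h2 : b ≤ m ‖z.1‖ := hb ⟨z.1, by simpa using h1, rfl⟩
    have h3 : ‖z.2‖ ≤ √(1 + ‖z.2‖ ^ 2) := Real.le_sqrt_of_sq_le (by linarith)
    rw [mem_closedBall_zero_iff]
    refine max_le_max h1 ?_
    rw [le_div_iff₀ (Real.exp_pos _)]
    have h4 := Real.exp_le_exp.2 h2
    nlinarith [Real.exp_pos b, norm_nonneg z.2]

lemma sublevel_subset {e : ℝ} (he : e < s.E₀) : {z | s.E z ≤ e} ⊆ s.S₀ :=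
  fun _ hz => lt_of_le_of_lt hz he

lemma exists_sublevel_of_isCompact {K : Set Phase} (hK : IsCompact K) (hKS : K ⊆ s.S₀) :
    ∃ e < s.E₀, K ⊆ {z | s.E z ≤ e} := by
  rcases K.eq_empty_or_nonempty with rfl | hne
  · exact ⟨s.E₀ - 1, by linarith, Set.empty_subset _⟩
  · obtain ⟨z, hz, hmax⟩ := hK.exists_isMaxOn hne s.contDiff_E.continuous.continuousOn
    exact ⟨s.E z, hKS hz, fun y hy => hmax hy⟩

lemma contDiff_E_one : ContDiff ℝ 1 s.E := s.contDiff_E.of_le one_le_two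

lemma isSphericallySymmetric_comp_E_mul (θ : ℝ → ℝ) {u : Phase → ℝ}
    (hu : IsSphericallySymmetric u) : IsSphericallySymmetric fun z => θ (s.E z) * u z := by
  intro A hA
  filter_upwards [hu A hA] with z hz
  rw [s.E_rotate, hz]

lemma isSphericallySymmetric_classicalT {ξ : Phase → ℝ} (hξ : ContDiff ℝ 1 ξ)
    (hs : IsSphericallySymmetric ξ) : IsSphericallySymmetric (s.classicalT ξ) := by
  intro A hA
  have h := hs.eq_of_continuous hξ.continuous hA
  refine Eventually.of_forall fun z => ?_
  rw [classicalT, poissonBracket, poissonBracket, gradX_rotate hξ h, gradV_rotate hξ h,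
    gradX_rotate s.contDiff_E_one (s.E_rotate A), gradV_rotate s.contDiff_E_one (s.E_rotate A),
    A.inner_map_map, A.inner_map_map]

/-- Moments determine the integrals against all continuous functions of the energy. -/
lemma integral_comp_E_mul_eq_zero {h : Phase → ℝ} {e : ℝ} (he : e < s.E₀) (hi : Integrable h)
    (h0 : ∀ z, e < s.E z → h z = 0)
    (hpoly : ∀ p : Polynomial ℝ, ∫ z, p.eval (s.E z) * h z = 0)
    {k : ℝ → ℝ} (hk : ContinuousOn k (Set.Iio s.E₀)) : ∫ z, k (s.E z) * h z = 0 := by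
  obtain ⟨m, hm⟩ := (s.isCompact_sublevel he).bddBelow_image s.contDiff_E.continuous.continuousOn
  have hkK : ContinuousOn (fun z => k (s.E z)) {z | s.E z ≤ e} :=
    hk.comp s.contDiff_E.continuous.continuousOn fun z hz => lt_of_le_of_lt hz he
  have hint : ∀ F : Phase → ℝ, ContinuousOn F {z | s.E z ≤ e} →
      Integrable fun z => F z * h z := fun F hF => by
    have h1 : IntegrableOn (fun z => F z * h z) {z | s.E z ≤ e} :=
      hi.integrableOn.continuousOn_mul hF (s.isCompact_sublevel he)
    refine (integrableOn_iff_integrable_of_support_subset fun z hz => ?_).1 h1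
    by_contra hn
    exact hz (by simp [h0 z (not_le.1 hn)])
  have bound : ∀ ε > 0, |∫ z, k (s.E z) * h z| ≤ ε * ∫ z, |h z| := fun ε hε => by
    -- On the sublevel set containing the support of `h`, the energy takes values in [m, e], a
    -- compact part of (-∞, E₀), so Weierstrass approximation applies to `k`.
    obtain ⟨p, hp⟩ := exists_polynomial_near_of_continuousOn m e k
      (hk.mono fun x hx => lt_of_le_of_lt hx.2 he) ε hε
    have hpc : Continuous fun z => p.eval (s.E z) := p.continuous.comp s.contDiff_E.continuous
    rw [← sub_zero (∫ z, k (s.E z) * h z), ← hpoly p,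
      ← integral_sub (hint _ hkK) (hint _ hpc.continuousOn), ← Real.norm_eq_abs,
      ← integral_const_mul]
    refine norm_integral_le_of_norm_le (hi.abs.const_mul ε) (Eventually.of_forall fun z => ?_)
    by_cases hz : s.E z ≤ e
    · rw [← sub_mul, Real.norm_eq_abs, abs_mul, abs_sub_comm]
      exact mul_le_mul_of_nonneg_right (hp _ ⟨hm ⟨z, hz, rfl⟩, hz⟩).le (abs_nonneg _)
    · simp [h0 z (not_le.1 hz)]
  have hlim : Tendsto (fun ε : ℝ => ε * ∫ z, |h z|) (𝓝[>] 0) (𝓝 0) := by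
    have : Tendsto (fun ε : ℝ => ε * ∫ z, |h z|) (𝓝 0) (𝓝 (0 * ∫ z, |h z|)) :=
      tendsto_id.mul_const _
    rw [zero_mul] at this
    exact this.mono_left nhdsWithin_le_nhds
  exact abs_nonpos_iff.1 (ge_of_tendsto hlim (eventually_nhdsWithin_of_forall bound))

end IsotropicSteadyState

/-! ### Localization in energy and removal of the weight -/

lemma integrable_mul_of_continuousOn {F G : Phase → ℝ} {K : Set Phase} (hK : IsCompact K)
    (hF : Integrable F) (hF0 : ∀ z ∉ K, F z = 0) (hG : ContinuousOn G K) :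
    Integrable fun z => F z * G z := by
  refine (integrableOn_iff_integrable_of_support_subset fun z hz => ?_).1
    (hF.integrableOn.mul_continuousOn hG hK)
  by_contra hn
  exact hz (by simp [hF0 z hn])

/-- Mollification commutes with the derivatives of ξ, which are continuous with compact support; `F`
only has to be integrable. This serves to pass from smooth to C¹ test functions. -/
lemma tendsto_integral_mul_poissonBracket_smoothen {E F ξ : Phase → ℝ} {K : Set Phase}
    (hK : IsCompact K) (hE : ContDiff ℝ 1 E) (hF : Integrable F) (hF0 : ∀ z ∉ K, F z = 0)
    (hξ : ContDiff ℝ 1 ξ) (hξc : HasCompactSupport ξ) :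
    Tendsto (fun n => ∫ z, F z * poissonBracket (smoothen n ξ) E z) atTop
      (𝓝 (∫ z, F z * poissonBracket ξ E z)) := by
  have hρ := isMollifier_sphericalMollifier
  have hdE : ∀ v, Continuous fun z => fderiv ℝ E z v := fun v =>
    (hE.continuous_fderiv one_ne_zero).clm_apply continuous_const
  have hFE : ∀ v, Integrable fun z => F z * fderiv ℝ E z v := fun v =>
    integrable_mul_of_continuousOn hK hF hF0 (hdE v).continuousOn
  have expand : ∀ u : Phase → ℝ, ContDiff ℝ 1 u → ∫ z, F z * poissonBracket u E z =
      ∑ i, ((∫ z, F z * fderiv ℝ E z (velDir i) * fderiv ℝ u z (posDir i)) -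
        ∫ z, F z * fderiv ℝ E z (posDir i) * fderiv ℝ u z (velDir i)) := fun u hu => by
    have hdu : ∀ v, Continuous fun z => fderiv ℝ u z v := fun v =>
      (hu.continuous_fderiv one_ne_zero).clm_apply continuous_const
    have hi : ∀ v w, Integrable fun z => F z * fderiv ℝ E z v * fderiv ℝ u z w := fun v w =>
      integrable_mul_of_continuousOn hK (hFE v) (fun z hz => by simp [hF0 z hz])
        (hdu w).continuousOn
    simp only [poissonBracket_eq hE hu, hamiltonianDeriv, Finset.mul_sum, mul_sub, ← mul_assoc]
    refine (integral_finsetSum _ fun i _ => (hi (velDir i) (posDir i)).sub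
      (hi (posDir i) (velDir i))).trans ?_
    exact Finset.sum_congr rfl fun i _ => integral_sub (hi _ _) (hi _ _)
  have hu' : ∀ n, ContDiff ℝ 1 (smoothen n ξ) := fun n =>
    (contDiff_mollify (hρ.smooth n) (hρ.hasCompactSupport n)
      hξ.continuous.locallyIntegrable).of_le (by norm_cast)
  have lim : ∀ v w, Tendsto (fun n => ∫ z, F z * fderiv ℝ E z v * fderiv ℝ (smoothen n ξ) z w)
      atTop (𝓝 (∫ z, F z * fderiv ℝ E z v * fderiv ℝ ξ z w)) := fun v w => by
    simp only [smoothen, fderiv_mollify_right (hρ.integrable _).locallyIntegrable hξ hξc]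
    exact hρ.tendsto_integral_mul_mollify (hFE v)
      ((hξ.continuous_fderiv one_ne_zero).clm_apply continuous_const) (hξc.fderiv_apply ℝ w)
  rw [expand ξ hξ]
  simp only [fun n => expand _ (hu' n)]
  exact tendsto_finsetSum _ fun i _ => (lim _ _).sub (lim _ _)

namespace IsotropicSteadyState

variable {s : IsotropicSteadyState}

lemma integrable_indicator_weight_mul {f : Phase → ℝ} {K : Set Phase}
    (hf : LocallyIntegrableOn f s.S₀) (hK : IsCompact K) (hKS : K ⊆ s.S₀) :
    Integrable (K.indicator fun z => s.weight z * f z) := by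
  rw [integrable_indicator_iff hK.measurableSet]
  exact (hf.integrableOn_compact_subset hKS hK).continuousOn_mul
    (s.continuousOn_weight.mono hKS) hK

lemma setIntegral_weight_mul {f u : Phase → ℝ} {K : Set Phase} (hKS : K ⊆ s.S₀)
    (hu : ∀ z ∉ K, u z = 0) :
    ∫ z in s.S₀, s.weight z * (f z * u z) =
      ∫ z, K.indicator (fun z => s.weight z * f z) z * u z := by
  rw [← integral_indicator s.measurableSet_S₀]
  refine integral_congr_ae (Eventually.of_forall fun z => ?_)
  by_cases hz : z ∈ K
  · simp only [Set.indicator_of_mem (hKS hz), Set.indicator_of_mem hz, mul_assoc]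
  · by_cases hzS : z ∈ s.S₀ <;> simp [hu z hz, hzS]

/-- The weak formulation extends to test functions of class `C¹`. -/
lemma IsWeakT.integral_eq_of_contDiff_one {f g ξ : Phase → ℝ} (h : s.IsWeakT f g)
    (hξ : ContDiff ℝ 1 ξ) (hξc : HasCompactSupport ξ) (hξS : tsupport ξ ⊆ s.S₀)
    (hξs : IsSphericallySymmetric ξ) :
    ∫ z in s.S₀, s.weight z * (f z * s.classicalT ξ z) =
      -∫ z in s.S₀, s.weight z * (g z * ξ z) := by
  have hρ := isMollifier_sphericalMollifier
  -- Mollifications of radius 1/(n+1) < δ keep their support in the compact δ-thickening, inside S₀,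
  -- and so are admissible test functions for large n.
  obtain ⟨δ, hδ, hδS⟩ := hξc.isCompact.exists_cthickening_subset_open s.isOpen_S₀ hξS
  set K := Metric.cthickening δ (tsupport ξ)
  have hK : IsCompact K := hξc.isCompact.cthickening
  have hξK : tsupport ξ ⊆ K := Metric.self_subset_cthickening _
  have hsm : ∀ n, ContDiff ℝ ∞ (smoothen n ξ) := fun n =>
    contDiff_mollify (hρ.smooth n) (hρ.hasCompactSupport n) hξ.continuous.locallyIntegrable
  have hsupp : ∀ᶠ n : ℕ in atTop, tsupport (smoothen n ξ) ⊆ K := by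
    filter_upwards [(tendsto_one_div_add_atTop_nhds_zero_nat (𝕜 := ℝ)).eventually
      (gt_mem_nhds hδ)] with n hn
    refine closure_minimal (fun z hz => ?_) Metric.isClosed_cthickening
    obtain ⟨x, hx, y, hy, rfl⟩ := Set.mem_add.1 (support_convolution_subset _ hz)
    refine Metric.mem_cthickening_of_dist_le _ x _ _ (subset_tsupport _ hx) ?_
    have := hρ.tsupport_subset n (subset_tsupport _ hy)
    rw [mem_closedBall_zero_iff] at this
    simpa [dist_eq_norm] using this.trans hn.le
  have key : ∀ (v u : Phase → ℝ), ContDiff ℝ 1 u → tsupport u ⊆ K →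
      ∫ z in s.S₀, s.weight z * (v z * s.classicalT u z) =
        ∫ z, K.indicator (fun z => s.weight z * v z) z * s.classicalT u z := fun v u hu huK =>
    setIntegral_weight_mul hδS fun z hz => s.classicalT_eq_zero hu fun h' => hz (huK h')
  have key' : ∀ (v u : Phase → ℝ), tsupport u ⊆ K →
      ∫ z in s.S₀, s.weight z * (v z * u z) =
        ∫ z, K.indicator (fun z => s.weight z * v z) z * u z := fun v u huK =>
    setIntegral_weight_mul hδS fun z hz =>
      image_eq_zero_of_notMem_tsupport fun h' => hz (huK h')
  have hF0 : ∀ v : Phase → ℝ, ∀ z ∉ K, K.indicator (fun z => s.weight z * v z) z = 0 :=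
    fun v z hz => Set.indicator_of_notMem hz _
  rw [key f ξ hξ hξK, key' g ξ hξK]
  have t1 := tendsto_integral_mul_poissonBracket_smoothen hK s.contDiff_E_one
    (integrable_indicator_weight_mul h.1.1 hK hδS) (hF0 f) hξ hξc
  have t2 := (hρ.tendsto_integral_mul_mollify (integrable_indicator_weight_mul h.2.1.1 hK hδS)
    hξ.continuous hξc).neg
  refine tendsto_nhds_unique t1 (t2.congr' ?_)
  filter_upwards [hsupp] with n hn
  have hn1 : ContDiff ℝ 1 (smoothen n ξ) := (hsm n).of_le (by norm_cast)
  rw [← key' g _ hn, ← h.2.2 _ ⟨hsm n, HasCompactSupport.convolution _ hξc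
    (hρ.hasCompactSupport n), hn.trans hδS, hξs.smoothen n⟩, key f _ hn1 hn]
  rfl

lemma tsupport_comp_E_mul_subset {θ : ℝ → ℝ} {e : ℝ} (hθ : ∀ t, e < t → θ t = 0)
    (u : Phase → ℝ) : tsupport (fun z => θ (s.E z) * u z) ⊆ {z | s.E z ≤ e} := by
  refine closure_minimal (fun z hz => ?_) (isClosed_le s.contDiff_E.continuous continuous_const)
  by_contra hn
  exact hz (by simp [hθ _ (not_le.1 hn)])

/-- The weak relation localized to a sublevel set of the energy. -/
lemma IsWeakT.integral_comp_E_mul {f g ξ : Phase → ℝ} {θ : ℝ → ℝ} {e : ℝ} (h : s.IsWeakT f g)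
    (he : e < s.E₀) (hθ : ContDiff ℝ 1 θ) (hθ0 : ∀ t, e < t → θ t = 0) (hξ : ContDiff ℝ ∞ ξ)
    (hξc : HasCompactSupport ξ) (hξs : IsSphericallySymmetric ξ) :
    ∫ z, θ (s.E z) * s.weight z * f z * poissonBracket ξ s.E z =
      -∫ z, θ (s.E z) * s.weight z * g z * ξ z := by
  have hξ1 : ContDiff ℝ 1 ξ := hξ.of_le (by norm_cast)
  have h1 := h.integral_eq_of_contDiff_one (ξ := fun z => θ (s.E z) * ξ z)
    ((hθ.comp s.contDiff_E_one).mul hξ1) hξc.mul_left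
    ((tsupport_comp_E_mul_subset hθ0 ξ).trans (s.sublevel_subset he))
    (s.isSphericallySymmetric_comp_E_mul θ hξs)
  have hS : ∀ z ∉ s.S₀, θ (s.E z) = 0 := fun z hz => hθ0 _ (lt_of_lt_of_le he (not_lt.1 hz))
  rw [setIntegral_eq_integral_of_forall_compl_eq_zero,
    setIntegral_eq_integral_of_forall_compl_eq_zero] at h1
  · simp only [classicalT, poissonBracket_comp_mul s.contDiff_E_one hθ hξ1] at h1
    refine Eq.trans ?_ (h1.trans (congrArg _ ?_)) <;>
      exact integral_congr_ae (Eventually.of_forall fun z => by simp only; ring)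
  · intro z hz
    simp [hS z hz]
  · intro z hz
    simp only [classicalT]
    rw [poissonBracket_comp_mul s.contDiff_E_one hθ hξ1, hS z hz]
    simp

variable (s)

/-- On a compact sublevel set the weight is continuous and positive, so m²/weight is bounded there
and m² f² is controlled by weight · f². -/
lemma memLp_of_continuousOn_mul {f m : Phase → ℝ} {e : ℝ} (he : e < s.E₀)
    (hf : MemLp f 2 s.weightedMeasure) (hm : ContinuousOn m s.S₀)
    (hm0 : ∀ z, e < s.E z → m z = 0) : MemLp (fun z => m z * f z) 2 volume := by
  have hK := s.isCompact_sublevel he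
  set K := {z | s.E z ≤ e}
  have hKS : K ⊆ s.S₀ := s.sublevel_subset he
  have h0 : (fun z => m z * f z) = K.indicator fun z => m z * f z := by
    ext z
    by_cases hz : z ∈ K
    · rw [Set.indicator_of_mem hz]
    · rw [Set.indicator_of_notMem hz, hm0 z (not_le.1 hz), zero_mul]
  rw [h0, memLp_indicator_iff_restrict hK.measurableSet]
  have hfi : IntegrableOn f K :=
    (s.locallyIntegrableOn_of_memLp hf).integrableOn_compact_subset hKS hK
  refine (memLp_two_iff_integrable_sq
    (((hm.mono hKS).aestronglyMeasurable hK.measurableSet).mul hfi.1)).2 ?_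
  have h2 : Integrable (fun z => f z ^ 2) s.weightedMeasure := hf.integrable_sq
  rw [weightedMeasure, integrable_withDensity_iff_integrable_smul'
    s.measurable_weight.ennreal_ofReal (by simp)] at h2
  have h3 := (IntegrableOn.mono_set h2 hKS).mul_continuousOn (((hm.mono hKS).pow 2).mul
    ((s.continuousOn_weight.mono hKS).inv₀ fun z hz => (s.weight_pos (hKS hz)).ne')) hK
  refine h3.congr_fun (fun z hz => ?_) hK.measurableSet
  have hw := s.weight_pos (hKS hz)
  simp only [smul_eq_mul, ENNReal.toReal_ofReal hw.le, Pi.mul_apply, Pi.pow_apply, Pi.inv_apply]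
  field_simp

/-- The unweighted weak relation localized to a sublevel set of the energy. -/
lemma IsWeakT.integral_comp_E_mul_unweighted {f g ξ : Phase → ℝ} {θ : ℝ → ℝ} {e : ℝ}
    {s : IsotropicSteadyState} (h : s.IsWeakT f g)
    (he : e < s.E₀) (hθ : ContDiff ℝ 1 θ) (hθ0 : ∀ t, e < t → θ t = 0) (hξ : ContDiff ℝ ∞ ξ)
    (hξc : HasCompactSupport ξ) (hξs : IsSphericallySymmetric ξ) :
    ∫ z, θ (s.E z) * f z * poissonBracket ξ s.E z = -∫ z, θ (s.E z) * g z * ξ z := by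
  have hK := s.isCompact_sublevel he
  have hKS := s.sublevel_subset he
  have hξ1 : ContDiff ℝ 1 ξ := hξ.of_le (by norm_cast)
  have hTc : Continuous (s.classicalT ξ) := s.continuous_classicalT hξ1
  have hθK : ∀ z ∉ {z | s.E z ≤ e}, θ (s.E z) = 0 := fun z hz => hθ0 _ (not_le.1 hz)
  have hθE : Continuous fun z => θ (s.E z) := hθ.continuous.comp s.contDiff_E.continuous
  have hint : ∀ (v m : Phase → ℝ), LocallyIntegrableOn v s.S₀ →
      ContinuousOn m {z | s.E z ≤ e} → Integrable fun z => θ (s.E z) * v z * m z :=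
    fun v m hv hm => by
      have h1 : IntegrableOn (fun z => θ (s.E z) * v z * m z) {z | s.E z ≤ e} :=
        ((hv.integrableOn_compact_subset hKS hK).continuousOn_mul hθE.continuousOn
          hK).mul_continuousOn hm hK
      refine (integrableOn_iff_integrable_of_support_subset fun z hz => ?_).1 h1
      by_contra hn
      exact hz (by simp [hθK z hn])
  have hw : ContinuousOn s.weight {z | s.E z ≤ e} := s.continuousOn_weight.mono hKS
  have i1 := hint f (fun z => s.weight z * s.classicalT ξ z) h.1.1 (hw.mul hTc.continuousOn)
  have i2 := hint g (fun z => s.weight z * ξ z) h.2.1.1 (hw.mul hξ.continuous.continuousOn)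
  have hd : ContinuousOn (fun t => |deriv s.φ t|) (Set.Iio s.E₀) :=
    (s.ansatz.contDiffOn.continuousOn_deriv_of_isOpen isOpen_Iio le_rfl).abs
  -- Since φ' is merely continuous, |φ'| cannot be absorbed into the C¹ cutoff. Instead the weighted
  -- relation is used with cutoffs p θ for all polynomials p, and Weierstrass approximation then
  -- allows the factor |φ' ∘ E|, which cancels the weight.
  have hz := s.integral_comp_E_mul_eq_zero he (i1.add i2)
    (fun z hz => by simp [hθ0 _ hz]) (fun p => ?_) hd
  · have e1 : ∀ z, |deriv s.φ (s.E z)| * ((fun z => θ (s.E z) * f z *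
        (s.weight z * s.classicalT ξ z)) + fun z => θ (s.E z) * g z * (s.weight z * ξ z)) z =
        θ (s.E z) * f z * poissonBracket ξ s.E z + θ (s.E z) * g z * ξ z := fun z => by
      by_cases hz : s.E z ≤ e
      · have hw : |deriv s.φ (s.E z)| * s.weight z = 1 :=
          mul_one_div_cancel (abs_pos.2 (s.ansatz.deriv_neg _ (hz.trans_lt he)).ne).ne'
        simp only [Pi.add_apply, classicalT]
        linear_combination (θ (s.E z) * f z * poissonBracket ξ s.E z + θ (s.E z) * g z * ξ z) * hw
      · simp [hθK z hz]
    simp only [e1] at hz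
    exact eq_neg_of_add_eq_zero_left ((integral_add (hint f _ h.1.1 hTc.continuousOn)
      (hint g _ h.2.1.1 hξ.continuous.continuousOn)).symm.trans hz)
  · have h1 := h.integral_comp_E_mul he (θ := fun t => p.eval t * θ t)
      ((by simpa using p.contDiff_aeval (𝕜 := ℝ) 1 : ContDiff ℝ 1 fun t => p.eval t).mul hθ)
      (fun t ht => by simp [hθ0 t ht]) hξ hξc hξs
    have hpc : Continuous fun z => p.eval (s.E z) := p.continuous.comp s.contDiff_E.continuous
    have j1 := hint f (fun z => p.eval (s.E z) * s.weight z * s.classicalT ξ z) h.1.1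
      ((hpc.continuousOn.mul hw).mul hTc.continuousOn)
    have j2 := hint g (fun z => p.eval (s.E z) * s.weight z * ξ z) h.2.1.1
      ((hpc.continuousOn.mul hw).mul hξ.continuous.continuousOn)
    rw [← add_eq_zero_iff_eq_neg] at h1
    refine Eq.trans ?_ h1
    refine Eq.trans (Eq.trans ?_ (integral_add j1 j2)) (congrArg₂ _ ?_ ?_) <;>
      refine integral_congr_ae (Eventually.of_forall fun z => ?_) <;>
      simp only [Pi.add_apply, classicalT] <;> ring

end IsotropicSteadyState

/-! ### Skew symmetry and single-valuedness by energy cutoffs -/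

/-- Smooth cutoff functions of the energy, exhausting `(-∞, e₀)`. -/
noncomputable def energyCutoff (e₀ : ℝ) (n : ℕ) (t : ℝ) : ℝ :=
  Real.smoothTransition (((n : ℝ) + 1) * (e₀ - t) - 1)

lemma contDiff_energyCutoff (e₀ : ℝ) (n : ℕ) : ContDiff ℝ 1 (energyCutoff e₀ n) :=
  Real.smoothTransition.contDiff.comp (by fun_prop)

lemma energyCutoff_eq_zero {e₀ : ℝ} {n : ℕ} {t : ℝ} (h : e₀ - 1 / ((n : ℝ) + 1) < t) :
    energyCutoff e₀ n t = 0 := by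
  refine Real.smoothTransition.zero_of_nonpos ?_
  have h1 : e₀ - t < 1 / ((n : ℝ) + 1) := by linarith
  rw [lt_div_iff₀' (by positivity)] at h1
  linarith

lemma eventually_energyCutoff_eq_one {e₀ t : ℝ} (h : t < e₀) :
    ∀ᶠ n in atTop, energyCutoff e₀ n t = 1 := by
  have h1 : Tendsto (fun n : ℕ => ((n : ℝ) + 1) * (e₀ - t)) atTop atTop :=
    (tendsto_natCast_atTop_atTop.atTop_add tendsto_const_nhds).atTop_mul_const (sub_pos.2 h)
  filter_upwards [h1.eventually_ge_atTop 2] with n hn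
  exact Real.smoothTransition.one_of_one_le (by linarith)

namespace IsotropicSteadyState

variable {s : IsotropicSteadyState}

lemma sub_inv_lt_cutoff (s : IsotropicSteadyState) (n : ℕ) :
    s.E₀ - 1 / ((n : ℝ) + 1) < s.E₀ := by
  have : (0 : ℝ) < 1 / ((n : ℝ) + 1) := by positivity
  linarith

lemma continuous_energyCutoff (s : IsotropicSteadyState) (n : ℕ) :
    Continuous fun z => energyCutoff s.E₀ n (s.E z) :=
  (contDiff_energyCutoff s.E₀ n).continuous.comp s.contDiff_E.continuous

lemma energyCutoff_eq_zero_of_notMem (n : ℕ) {z : Phase} (hz : z ∉ s.S₀) :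
    energyCutoff s.E₀ n (s.E z) = 0 :=
  energyCutoff_eq_zero ((s.sub_inv_lt_cutoff n).trans_le (not_lt.1 hz))

lemma memLp_energyCutoff_mul {f : Phase → ℝ} (hf : MemLp f 2 s.weightedMeasure) (n : ℕ) :
    MemLp (fun z => energyCutoff s.E₀ n (s.E z) * f z) 2 volume :=
  s.memLp_of_continuousOn_mul (s.sub_inv_lt_cutoff n) hf
    (s.continuous_energyCutoff n).continuousOn fun _ hz => energyCutoff_eq_zero hz

lemma memLp_energyCutoff_mul_weight_mul {f : Phase → ℝ} (hf : MemLp f 2 s.weightedMeasure)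
    (n : ℕ) :
    MemLp (fun z => energyCutoff s.E₀ n (s.E z) * s.weight z * f z) 2 volume :=
  s.memLp_of_continuousOn_mul (s.sub_inv_lt_cutoff n) hf
    ((s.continuous_energyCutoff n).continuousOn.mul s.continuousOn_weight)
    fun z hz => by simp [energyCutoff_eq_zero hz]

lemma isSphericallySymmetric_mul {f m : Phase → ℝ} (hf : s.IsL1LocR f)
    (hm : ∀ A z, m (rotate A z) = m z) (hm0 : ∀ z ∉ s.S₀, m z = 0) :
    IsSphericallySymmetric fun z => m z * f z := by
  intro A hA
  filter_upwards [hf.2 A hA] with z hz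
  by_cases hzS : z ∈ s.S₀
  · rw [Set.indicator_of_mem hzS, Set.indicator_of_mem ((s.rotate_mem_S₀ A z).2 hzS)] at hz
    rw [hm, hz]
  · rw [hm, hm0 z hzS, zero_mul, zero_mul]

lemma isSphericallySymmetric_energyCutoff_mul {f : Phase → ℝ} (hf : s.IsL1LocR f) (n : ℕ) :
    IsSphericallySymmetric fun z => energyCutoff s.E₀ n (s.E z) * f z :=
  isSphericallySymmetric_mul hf (fun A z => by rw [s.E_rotate])
    fun _ hz => energyCutoff_eq_zero_of_notMem n hz

lemma isSphericallySymmetric_energyCutoff_mul_weight_mul {f : Phase → ℝ} (hf : s.IsL1LocR f)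
    (n : ℕ) :
    IsSphericallySymmetric fun z => energyCutoff s.E₀ n (s.E z) * s.weight z * f z :=
  isSphericallySymmetric_mul hf (fun A z => by rw [s.E_rotate, s.weight_rotate])
    fun z hz => by rw [energyCutoff_eq_zero_of_notMem n hz, zero_mul]

/-- The weak transport relation is skew symmetric. -/
lemma IsWeakT.skew {f g q p : Phase → ℝ} (hfg : s.IsWeakT f g) (hqp : s.IsWeakT q p)
    (hf : MemLp f 2 s.weightedMeasure) (hg : MemLp g 2 s.weightedMeasure)
    (hq : MemLp q 2 s.weightedMeasure) (hp : MemLp p 2 s.weightedMeasure) :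
    (∫ z in s.S₀, s.weight z * (f z * p z)) + ∫ z in s.S₀, s.weight z * (g z * q z) = 0 := by
  have int : ∀ {u v : Phase → ℝ}, MemLp u 2 s.weightedMeasure → MemLp v 2 s.weightedMeasure →
      IntegrableOn (fun z => s.weight z * (u z * v z)) s.S₀ := fun {u v} hu hv => by
    have h : Integrable (fun z => u z * v z) s.weightedMeasure := hu.integrable_mul hv
    rw [weightedMeasure, integrable_withDensity_iff_integrable_smul'
      s.measurable_weight.ennreal_ofReal (by simp)] at h
    refine IntegrableOn.congr_fun h (fun z hz => ?_) s.measurableSet_S₀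
    simp [(s.weight_pos hz).le]
  have cut : ∀ n, ∫ z in s.S₀, energyCutoff s.E₀ n (s.E z) ^ 2 *
      (s.weight z * (f z * p z) + s.weight z * (g z * q z)) = 0 := fun n => by
    have he := s.sub_inv_lt_cutoff n
    have hz0 : ∀ z ∉ {z | s.E z ≤ s.E₀ - 1 / ((n : ℝ) + 1)},
        energyCutoff s.E₀ n (s.E z) = 0 := fun z hz => energyCutoff_eq_zero (not_le.1 hz)
    -- The weight is attached to the pair (f, g) and removed from (q, p), so each product carries it
    -- exactly once; both pairs carry a cutoff, whence the square.
    have hsum := integral_add_integral_eq_zero_of_weak s.contDiff_E (s.isCompact_sublevel he)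
      (memLp_energyCutoff_mul_weight_mul hf n) (memLp_energyCutoff_mul_weight_mul hg n)
      (memLp_energyCutoff_mul hq n) (memLp_energyCutoff_mul hp n)
      (fun z hz => by simp [hz0 z hz]) (fun z hz => by simp [hz0 z hz])
      (fun z hz => by simp [hz0 z hz])
      (isSphericallySymmetric_energyCutoff_mul_weight_mul hfg.1 n)
      (isSphericallySymmetric_energyCutoff_mul hqp.1 n)
      (fun ξ h1 h2 h3 => hfg.integral_comp_E_mul he (contDiff_energyCutoff _ n)
        (fun _ => energyCutoff_eq_zero) h1 h2 h3)
      (fun ξ h1 h2 h3 => hqp.integral_comp_E_mul_unweighted he (contDiff_energyCutoff _ n)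
        (fun _ => energyCutoff_eq_zero) h1 h2 h3)
    rw [setIntegral_eq_integral_of_forall_compl_eq_zero fun z hz => by
      simp [energyCutoff_eq_zero_of_notMem n hz]]
    refine Eq.trans (Eq.trans ?_ (integral_add
      ((memLp_energyCutoff_mul_weight_mul hf n).integrable_mul (memLp_energyCutoff_mul hp n))
      ((memLp_energyCutoff_mul_weight_mul hg n).integrable_mul
        (memLp_energyCutoff_mul hq n)))) hsum
    refine integral_congr_ae (Eventually.of_forall fun z => ?_)
    simp only [Pi.mul_apply]
    ring
  have hi := (int hf hp).add (int hg hq)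
  rw [← integral_add (int hf hp) (int hg hq)]
  refine tendsto_nhds_unique (tendsto_integral_of_dominated_convergence _ (fun n => ?_) hi.abs
    (fun n => Eventually.of_forall fun z => ?_) ?_) ((tendsto_congr cut).2 tendsto_const_nhds)
  · exact ((s.continuous_energyCutoff n).pow 2).aestronglyMeasurable.mul hi.1
  · rw [Real.norm_eq_abs, abs_mul]
    refine mul_le_of_le_one_left (abs_nonneg _) ?_
    rw [abs_of_nonneg (sq_nonneg _)]
    exact pow_le_one₀ (Real.smoothTransition.nonneg _) (Real.smoothTransition.le_one _)
  · filter_upwards [ae_restrict_mem s.measurableSet_S₀] with z hz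
    refine tendsto_const_nhds.congr' ?_
    filter_upwards [eventually_energyCutoff_eq_one hz] with n hn
    rw [hn, one_pow, one_mul]

/-- With f = 0 the unweighted relation makes each localized `g` orthogonal to all spherically
symmetric test functions, hence zero; countably many cutoffs exhaust S₀. -/
lemma IsWeakT.ae_eq_zero {f g : Phase → ℝ} (h : s.IsWeakT f g)
    (hf : f =ᵐ[volume.restrict s.S₀] 0) (hg : MemLp g 2 s.weightedMeasure) :
    g =ᵐ[volume.restrict s.S₀] 0 := by
  have h' : s.IsWeakT (fun _ => 0) g := h.congr hf EventuallyEq.rfl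
  have key : ∀ n, ∀ᵐ z, energyCutoff s.E₀ n (s.E z) * g z = 0 := fun n =>
    ae_eq_zero_of_integral_mul_smooth_eq_zero (s.isCompact_sublevel (s.sub_inv_lt_cutoff n))
      (memLp_energyCutoff_mul hg n)
      (fun z hz => by rw [energyCutoff_eq_zero (not_le.1 hz), zero_mul])
      (isSphericallySymmetric_energyCutoff_mul h.2.1 n)
      (fun ξ h1 h2 h3 => by
        simpa using h'.integral_comp_E_mul_unweighted (s.sub_inv_lt_cutoff n)
          (contDiff_energyCutoff _ n) (fun _ => energyCutoff_eq_zero) h1 h2 h3)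
  filter_upwards [ae_restrict_mem s.measurableSet_S₀, ae_restrict_of_ae (ae_all_iff.2 key)]
    with z hz hk
  obtain ⟨n, hn⟩ := (eventually_energyCutoff_eq_one hz).exists
  simpa [hn] using hk n

/-! ### Test functions as elements of the domain -/

lemma isL1LocR_of_continuous {u : Phase → ℝ} (hu : Continuous u) (hs : IsSphericallySymmetric u) :
    s.IsL1LocR u := by
  refine ⟨hu.locallyIntegrable.locallyIntegrableOn _, fun A hA => ?_⟩
  filter_upwards [hs A hA] with z hz
  by_cases hzS : z ∈ s.S₀
  · rw [Set.indicator_of_mem hzS, Set.indicator_of_mem ((s.rotate_mem_S₀ A z).2 hzS), hz]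
  · rw [Set.indicator_of_notMem hzS, Set.indicator_of_notMem (mt (s.rotate_mem_S₀ A z).1 hzS)]

lemma memLp_of_continuous {u : Phase → ℝ} {K : Set Phase} (hu : Continuous u) (hK : IsCompact K)
    (hKS : K ⊆ s.S₀) (hu0 : ∀ z ∉ K, u z = 0) : MemLp u 2 s.weightedMeasure := by
  rw [memLp_two_iff_integrable_sq hu.aestronglyMeasurable, weightedMeasure,
    integrable_withDensity_iff_integrable_smul' s.measurable_weight.ennreal_ofReal (by simp)]
  refine (s.integrableOn_pairing (hu.locallyIntegrable.locallyIntegrableOn _) hu hK hKS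
    hu0).congr_fun (fun z hz => ?_) s.measurableSet_S₀
  simp only [ENNReal.toReal_ofReal (s.weight_pos hz).le, smul_eq_mul, sq]

/-- By the product rule the claim is ∫ weight · 𝒯(ξη) = 0. With a polynomial p(E) as weight this is
Liouville's theorem for p(E) ξη; Weierstrass approximation reaches the actual weight, which need not
be differentiable. -/
lemma IsTestFunction.isWeakT {ξ : Phase → ℝ} (hξ : s.IsTestFunction ξ) :
    s.IsWeakT ξ (s.classicalT ξ) := by
  have hξ1 : ContDiff ℝ 1 ξ := hξ.smooth.of_le (by norm_cast)
  have hT := s.continuous_classicalT hξ1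
  refine ⟨isL1LocR_of_continuous hξ.smooth.continuous hξ.symm,
    isL1LocR_of_continuous hT (s.isSphericallySymmetric_classicalT hξ1 hξ.symm), fun η hη => ?_⟩
  have hη1 : ContDiff ℝ 1 η := hη.smooth.of_le (by norm_cast)
  obtain ⟨e, he, hKe⟩ := s.exists_sublevel_of_isCompact hξ.hasCompactSupport hξ.tsupport_subset
  have h1 : ContDiff ℝ 1 fun z => ξ z * η z := hξ1.mul hη1
  have hTc := s.continuous_classicalT h1
  have hz0 : ∀ z ∉ tsupport ξ, s.classicalT (fun z => ξ z * η z) z = 0 := fun z hz =>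
    s.classicalT_eq_zero h1 fun h' => hz (tsupport_mul_subset_left h')
  have hzero : ∫ z, s.weight z * s.classicalT (fun z => ξ z * η z) z = 0 := by
    have hw : ContinuousOn (fun t => 1 / |deriv s.φ t|) (Set.Iio s.E₀) :=
      continuousOn_const.div (s.ansatz.contDiffOn.continuousOn_deriv_of_isOpen isOpen_Iio
        le_rfl).abs fun t ht => (abs_pos.2 (s.ansatz.deriv_neg _ ht).ne).ne'
    refine s.integral_comp_E_mul_eq_zero he
      (hTc.integrable_of_hasCompactSupport (HasCompactSupport.intro hξ.hasCompactSupport hz0))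
      (fun z hz => hz0 z fun h' => hz.not_ge (hKe h')) (fun p => ?_) hw
    have hp : ContDiff ℝ 1 fun t => p.eval t := by simpa using p.contDiff_aeval (𝕜 := ℝ) 1
    have h2 := integral_poissonBracket s.contDiff_E ((hp.comp s.contDiff_E_one).mul h1)
      hξ.hasCompactSupport.mul_right.mul_left
    refine Eq.trans (integral_congr_ae (Eventually.of_forall fun z => ?_)) h2
    exact (poissonBracket_comp_mul s.contDiff_E_one hp h1 z).symm
  rw [← setIntegral_eq_integral_of_forall_compl_eq_zero (s := s.S₀) fun z hz => by
    rw [hz0 z fun h' => hz (hξ.tsupport_subset h'), mul_zero]] at hzero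
  rw [← add_eq_zero_iff_eq_neg]
  have hL : s.IsL1LocR ξ := isL1LocR_of_continuous hξ.smooth.continuous hξ.symm
  have hLT : s.IsL1LocR (s.classicalT ξ) :=
    isL1LocR_of_continuous hT (s.isSphericallySymmetric_classicalT hξ1 hξ.symm)
  rw [← integral_add (hη.integrableOn_classicalT hL) (hη.integrableOn_mul hLT), ← hzero]
  refine integral_congr_ae (Eventually.of_forall fun z => ?_)
  simp only [classicalT, poissonBracket_mul s.contDiff_E_one hξ1 hη1]
  ring

lemma IsTestFunction.exists_mem_weakGraph {ξ : Phase → ℝ} (hξ : s.IsTestFunction ξ) :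
    ∃ a ∈ s.weakGraph, (a.1 : Lp ℝ 2 s.weightedMeasure) =ᵐ[volume.restrict s.S₀] ξ ∧
      (a.2 : Lp ℝ 2 s.weightedMeasure) =ᵐ[volume.restrict s.S₀] s.classicalT ξ := by
  have hξ1 : ContDiff ℝ 1 ξ := hξ.smooth.of_le (by norm_cast)
  have hw := hξ.isWeakT
  have m1 : MemLp ξ 2 s.weightedMeasure := memLp_of_continuous hξ.smooth.continuous
    hξ.hasCompactSupport hξ.tsupport_subset fun z hz => image_eq_zero_of_notMem_tsupport hz
  have m2 : MemLp (s.classicalT ξ) 2 s.weightedMeasure :=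
    memLp_of_continuous (s.continuous_classicalT hξ1) hξ.hasCompactSupport hξ.tsupport_subset
      fun z hz => s.classicalT_eq_zero hξ1 hz
  have e1 := s.ae_eq_restrict m1.coeFn_toLp
  have e2 := s.ae_eq_restrict m2.coeFn_toLp
  exact ⟨(⟨m1.toLp, hw.1.congr e1.symm⟩, ⟨m2.toLp, hw.2.1.congr e2.symm⟩),
    hw.congr e1.symm e2.symm, e1, e2⟩

/-! ### The transport operator -/

variable (s)

lemma setIntegral_weight_mul_congr {f g ξ : Phase → ℝ} (h : f =ᵐ[volume.restrict s.S₀] g) :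
    ∫ z in s.S₀, s.weight z * (ξ z * f z) = ∫ z in s.S₀, s.weight z * (ξ z * g z) :=
  integral_congr_ae (h.mono fun z hz => by simp only [hz])

lemma eq_zero_of_mem_weakGraph {a : s.H × s.H} (ha : a ∈ s.weakGraph) (h : a.1 = 0) :
    a.2 = 0 := by
  have h1 : s.IsWeakT (a.1 : Lp ℝ 2 s.weightedMeasure) (a.2 : Lp ℝ 2 s.weightedMeasure) := ha
  have h2 := h1.ae_eq_zero (by
    rw [h]; exact s.ae_eq_restrict (Lp.coeFn_zero ℝ 2 s.weightedMeasure)) (Lp.memLp _)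
  exact Subtype.ext ((Lp.eq_zero_iff_ae_eq_zero).2 (s.ae_weightedMeasure_iff.2 h2))

/-- This is the well-definedness of 𝒯: a single-valued relation is the graph of its
`Submodule.toLinearPMap`. -/
lemma graph_transport : s.transport.graph = s.weakGraph :=
  Submodule.toLinearPMap_graph_eq _ fun _ => s.eq_zero_of_mem_weakGraph

/-- Pairs orthogonal, in the sense of the adjoint graph, to all test functions satisfy the weak
transport relation. -/
lemma mem_weakGraph_of_forall {x y : s.H}
    (h : ∀ a ∈ s.weakGraph, inner ℝ x a.2 = -inner ℝ y a.1) : (x, y) ∈ s.weakGraph := by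
  refine ⟨x.2, y.2, fun ξ hξ => ?_⟩
  obtain ⟨a, ha, h1, h2⟩ := hξ.exists_mem_weakGraph
  have h3 := h a ha
  rwa [inner_eq, inner_eq, s.setIntegral_weight_mul_congr h1,
    s.setIntegral_weight_mul_congr h2] at h3

lemma inner_add_inner_eq_zero {a b : s.H × s.H} (ha : a ∈ s.weakGraph) (hb : b ∈ s.weakGraph) :
    inner ℝ a.1 b.2 + inner ℝ a.2 b.1 = 0 := by
  rw [inner_eq, inner_eq]
  exact IsWeakT.skew ha hb (Lp.memLp _) (Lp.memLp _) (Lp.memLp _) (Lp.memLp _)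

/-- If `y` is orthogonal to the domain, then (0, y) satisfies the weak relation, and
single-valuedness forces y = 0. -/
lemma dense_domain_transport : Dense (s.transport.domain : Set s.H) := by
  rw [Submodule.dense_iff_topologicalClosure_eq_top,
    Submodule.topologicalClosure_eq_top_iff, Submodule.eq_bot_iff]
  intro y hy
  rw [Submodule.mem_orthogonal'] at hy
  refine s.eq_zero_of_mem_weakGraph (a := (0, y)) (s.mem_weakGraph_of_forall fun a ha => ?_) rfl
  rw [inner_zero_left, hy a.1 (s.mem_domain_transport.2 ⟨a.2, ha⟩), neg_zero]

/-- The forward direction needs the adjoint relation only on test functions, since these define the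
weak relation; the converse is skew symmetry on the whole domain. -/
lemma mem_graph_adjoint_transport (x : s.H × s.H) :
    x ∈ s.transport.adjoint.graph ↔ (x.1, -x.2) ∈ s.weakGraph := by
  rw [LinearPMap.adjoint_graph_eq_graph_adjoint s.dense_domain_transport,
    Submodule.mem_adjoint_iff, graph_transport]
  constructor
  · intro h
    refine s.mem_weakGraph_of_forall fun a ha => ?_
    have := h a.1 a.2 ha
    rw [inner_neg_left, neg_neg, real_inner_comm, real_inner_comm a.1]
    linarith
  · intro h a b hab
    have := s.inner_add_inner_eq_zero hab h
    rw [inner_neg_right] at this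
    linarith

end IsotropicSteadyState

/-- For every isotropic steady state, Newtonian or relativistic, the weak transport operator `𝒯` is
a well-defined (the weak relation is its graph), densely defined operator on `H`, and `𝒯* = -𝒯`. -/
theorem theorem2p3 (s : IsotropicSteadyState) :
    s.transport.graph = s.weakGraph ∧
      Dense (s.transport.domain : Set s.H) ∧
      s.transport.adjoint = -s.transport := by
  refine ⟨s.graph_transport, s.dense_domain_transport, LinearPMap.eq_of_eq_graph ?_⟩
  ext x
  rw [s.mem_graph_adjoint_transport, LinearPMap.neg_graph, s.graph_transport]
  constructor
  · intro h
    exact ⟨_, h, by simp⟩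
  · rintro ⟨y, hy, rfl⟩
    simpa using hy
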